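/- Let $p$ be a prime number and let $F$ be a (non-archimedean) local field with finite residue field of characteristic $p$, so that $F$ has characteristic $0$ or $p$. Fix a separable closure $\Omega$ of $F$; all extensions below are taken inside $\Omega$. Let $K = F(\sqrt[p-1]{F^\times})$ be the field obtained by adjoining to $F$ all $(p-1)$-th roots of all elements of $F^\times$. Let $C$ be the compositum of all separable extensions of $F$ of degree $p$. Then $C$ contains $K$, and $C$ is the maximal abelian extension $M$ of exponent $p$ of $K$: that is, $C|K$ is abelian, $\operatorname{Gal}(C|K)$ has exponent $p$, and $C$ contains every abelian extension of $K$ in $\Omega$ whose Galois group has exponent dividing $p$. Moreover, if $F$ has characteristic $0$ then $M = K(\sqrt[p]{K^\times})$, the field obtained by adjoining to $K$ all $p$-th roots of all elements of $K^\times$; if $F$ has characteristic $p$ then $M = K(\wp^{-1}(K))$, the field obtained by adjoining to $K$ all $y \in \Omega$ with $\wp(y) = y^p - y \in K$. -/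

import Mathlib

open scoped ValuativeRel

/-- The field `F(ⁿ√F^×)`, inside the extension `Ω` of `F`: all `n`-th roots in `Ω` of all elements
of `F^×` are adjoined to `F`. -/
noncomputable def radicalField (F Ω : Type*) [Field F] [Field Ω] [Algebra F Ω] (n : ℕ) :
    IntermediateField F Ω :=
  IntermediateField.adjoin F {y : Ω | ∃ x : F, x ≠ 0 ∧ y ^ n = algebraMap F Ω x}

/-- The field `F(℘⁻¹(F))` with `℘(y) = y ^ p - y`, inside the extension `Ω` of `F`. -/
noncomputable def artinSchreierField (F Ω : Type*) [Field F] [Field Ω] [Algebra F Ω] (p : ℕ) :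
    IntermediateField F Ω :=
  IntermediateField.adjoin F {y : Ω | ∃ x : F, y ^ p - y = algebraMap F Ω x}

/-- The compositum in `Ω` of all separable extensions of `F` of degree `p` contained in `Ω`. -/
noncomputable def compositumOfDegree (F Ω : Type*) [Field F] [Field Ω] [Algebra F Ω] (p : ℕ) :
    IntermediateField F Ω :=
  sSup {E : IntermediateField F Ω | Algebra.IsSeparable F E ∧ Module.finrank F E = p}

/-- `M` is the maximal abelian extension of exponent `p` of `K` inside `Ω`: it is abelian, its
Galois group has exponent exactly `p`, and it contains every abelian extension of `K` in `Ω`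
(finite or infinite) whose Galois group has exponent dividing `p`. -/
structure IsMaximalAbelianOfExponent {K Ω : Type*} [Field K] [Field Ω] [Algebra K Ω] (p : ℕ)
    (M : IntermediateField K Ω) : Prop where
  isAbelianGalois : IsAbelianGalois K M
  exponent_eq : Monoid.exponent (M ≃ₐ[K] M) = p
  le_of_isAbelianGalois : ∀ L : IntermediateField K Ω, IsAbelianGalois K L →
    Monoid.exponent (L ≃ₐ[K] L) ∣ p → L ≤ M

/-!
Write `K = F(ᵖ⁻¹√F^×)`, let `C` be the compositum of the separable extensions of `F` of degree `p`,
and let `maxAbelianField k Ω n` be the largest abelian extension of `k` in `Ω` of exponent dividing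
`n`. As `F` contains the `(p - 1)`-th roots of unity (Hensel), Kummer theory identifies `K` with
`maxAbelianField F Ω (p - 1)`. The field `M` is `maxAbelianField K Ω p`; it is `K(ᵖ√K^×)` or
`K(℘⁻¹(K))` by Kummer theory (`K` contains the `p`-th roots of unity, because the cyclotomic
extension has exponent dividing `p - 1`) or by Artin-Schreier theory. What has to be shown is
`M = C`, and this falls into three parts.

* `K ≤ C` (`radicalField_le_compositumOfDegree`). Up to `(p - 1)`-th powers, every `a ∈ F^×` has
  valuation between `1` and `p - 1`. Then `X ^ p - a X - a` is irreducible, since its roots have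
  valuation `v(a) / p`, and the differences `y` of its roots satisfy `y ^ (p - 1) ≈ a`, so Krasner's
  argument puts the `(p - 1)`-th roots of `a` into its splitting field, which lies in `C`. The same
  polynomials show that `C` has elements of degree `p`, whence `C ≠ K`.

* `C ≤ M` (`le_maxAbelianField_of_finrank_eq`). The Galois group of the normal closure of an
  extension of degree `p` is solvable (`isSolvable_gal`, by the ramification filtration), and it is
  a transitive group of permutations of `p` letters, hence a subgroup of the affine group of
  `ZMod p` (`exists_normal_of_isSolvable_of_index_eq_prime`). Its translation subgroup has order `p`
  and its fixed field, which has exponent dividing `p - 1`, lies in `K`.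

* `M ≤ C` (`mem_compositumOfDegree_of_mem_maxAbelianField`). By Kummer or Artin-Schreier theory, `M`
  is generated by elements each of which lies in `maxAbelianField K₀ Ω p` for some finite
  subextension `K₀` of `K`. In the Galois group `G` over `F` of the normal closure, the subgroup `V`
  belonging to `K₀` is elementary abelian, and `G ⧸ V` is abelian of exponent dividing `p - 1`, so
  that the action on `V` is diagonalizable over `ZMod p` and `V` has a complement. The invariant
  hyperplanes of `V`, multiplied by a complement, are subgroups of index `p`, and their intersection
  with `V` is trivial (`eq_one_of_forall_mem_of_index_eq_prime`): the extension is generated by `K₀`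
  and extensions of `F` of degree `p`.
-/

/-! ### The maximal abelian extension of given exponent -/

/-- The elements of `Ω` on which the group `Gal(Ω/k)` acts through an abelian quotient of exponent
dividing `n`. For `Ω` Galois over `k` this is the maximal abelian extension of `k` in `Ω` of
exponent dividing `n`. -/
def maxAbelianField (k Ω : Type*) [Field k] [Field Ω] [Algebra k Ω] (n : ℕ) :
    IntermediateField k Ω where
  carrier := {x | (∀ σ τ : Gal(Ω/k), σ (τ x) = τ (σ x)) ∧ ∀ σ : Gal(Ω/k), (σ ^ n) x = x}
  mul_mem' {a b} ha hb :=
    ⟨fun σ τ ↦ by simp [ha.1 σ τ, hb.1 σ τ], fun σ ↦ by rw [map_mul, ha.2 σ, hb.2 σ]⟩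
  add_mem' {a b} ha hb :=
    ⟨fun σ τ ↦ by simp [ha.1 σ τ, hb.1 σ τ], fun σ ↦ by rw [map_add, ha.2 σ, hb.2 σ]⟩
  algebraMap_mem' r := ⟨fun σ τ ↦ by simp, fun σ ↦ by simp⟩
  inv_mem' a ha := ⟨fun σ τ ↦ by simp [ha.1 σ τ], fun σ ↦ by rw [map_inv₀, ha.2 σ]⟩

section MaxAbelian

variable {k Ω : Type*} [Field k] [Field Ω] [Algebra k Ω] {n : ℕ}

/-- An intermediate field of a Galois extension contains every element fixed by all automorphisms
that fix the intermediate field. -/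
theorem IntermediateField.mem_of_forall_fixing [IsGalois k Ω] (L : IntermediateField k Ω) {x : Ω}
    (h : ∀ σ : Gal(Ω/k), (∀ y ∈ L, σ y = y) → σ x = x) : x ∈ L := by
  rw [← InfiniteGalois.fixedField_fixingSubgroup L, IntermediateField.mem_fixedField_iff]
  exact fun σ hσ ↦ h σ ((IntermediateField.mem_fixingSubgroup_iff _ _).1 hσ)

theorem le_maxAbelianField (L : IntermediateField k Ω) [Normal k Ω] [IsAbelianGalois k L]
    (h : Monoid.exponent Gal(L/k) ∣ n) : L ≤ maxAbelianField k Ω n := by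
  intro x hx
  have key (σ : Gal(Ω/k)) (y : L) : σ y = (AlgEquiv.restrictNormalHom L σ y : L) :=
    (AlgEquiv.restrictNormal_commutes σ L y).symm
  lift x to L using hx
  refine ⟨fun σ τ ↦ ?_, fun σ ↦ ?_⟩
  · rw [key τ, key σ, key σ, key τ, ← AlgEquiv.mul_apply, ← AlgEquiv.mul_apply,
      (IsMulCommutative.is_comm (M := Gal(L/k))).comm]
  · rw [key, map_pow, Monoid.exponent_dvd_iff_forall_pow_eq_one.1 h, AlgEquiv.one_apply]

theorem map_mem_of_le_maxAbelianField [IsGalois k Ω] {L : IntermediateField k Ω}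
    (hL : L ≤ maxAbelianField k Ω n) (σ : Gal(Ω/k)) {x : Ω} (hx : x ∈ L) : σ x ∈ L := by
  refine L.mem_of_forall_fixing fun τ hτ ↦ ?_
  rw [(hL hx).1 τ σ, hτ x hx]

theorem normal_of_le_maxAbelianField [IsGalois k Ω] {L : IntermediateField k Ω}
    (hL : L ≤ maxAbelianField k Ω n) : Normal k L :=
  IntermediateField.normal_iff_forall_map_le'.2 fun σ ↦ by
    rintro _ ⟨x, hx, rfl⟩
    exact map_mem_of_le_maxAbelianField hL σ hx

theorem isAbelianGalois_of_le_maxAbelianField [IsGalois k Ω] {L : IntermediateField k Ω}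
    (hL : L ≤ maxAbelianField k Ω n) : IsAbelianGalois k L := by
  have := normal_of_le_maxAbelianField hL
  have key (σ : Gal(Ω/k)) (y : L) : (AlgEquiv.restrictNormalHom L σ y : L) = σ y :=
    AlgEquiv.restrictNormal_commutes σ L y
  refine { is_comm := ⟨fun a b ↦ ?_⟩ }
  obtain ⟨σ, rfl⟩ := AlgEquiv.restrictNormalHom_surjective Ω a
  obtain ⟨τ, rfl⟩ := AlgEquiv.restrictNormalHom_surjective Ω b
  ext x
  simp only [AlgEquiv.mul_apply, key]
  exact (hL x.2).1 σ τ

theorem pow_eq_one_of_le_maxAbelianField [IsGalois k Ω] {L : IntermediateField k Ω}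
    (hL : L ≤ maxAbelianField k Ω n) (a : Gal(L/k)) : a ^ n = 1 := by
  have := normal_of_le_maxAbelianField hL
  obtain ⟨σ, rfl⟩ := AlgEquiv.restrictNormalHom_surjective Ω a
  ext x
  rw [← map_pow]
  exact (AlgEquiv.restrictNormal_commutes (σ ^ n) L x).trans ((hL x.2).2 σ)

end MaxAbelian

/-! ### Kummer theory and Artin-Schreier theory -/

section Kummer

variable {k L : Type*} [Field k] [Field L] [Algebra k L] {n : ℕ}

theorem adjoin_roots_eq_top_of_pow_eq_one [FiniteDimensional k L] [IsAbelianGalois k L] [NeZero n]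
    {ζ : k} (hζ : IsPrimitiveRoot ζ n) (h : ∀ σ : Gal(L/k), σ ^ n = 1) :
    IntermediateField.adjoin k {y : L | ∃ x : k, x ≠ 0 ∧ y ^ n = algebraMap k L x} = ⊤ := by
  classical
  set S := IntermediateField.adjoin k {y : L | ∃ x : k, x ≠ 0 ∧ y ^ n = algebraMap k L x} with hS
  rw [← IsGalois.fixedField_fixingSubgroup S]
  suffices S.fixingSubgroup = ⊥ by rw [this, IntermediateField.fixedField_bot]
  refine (Subgroup.eq_bot_iff_forall _).2 fun τ hτ ↦ ?_
  by_contra hne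
  let : CommGroup Gal(L/k) := { mul_comm := (IsMulCommutative.is_comm (M := Gal(L/k))).comm }
  have : HasEnoughRootsOfUnity k n := ⟨⟨ζ, hζ⟩, inferInstance⟩
  have : HasEnoughRootsOfUnity k (Monoid.exponent Gal(L/k)) :=
    HasEnoughRootsOfUnity.of_dvd k (Monoid.exponent_dvd_iff_forall_pow_eq_one.2 h)
  obtain ⟨χ, hχ⟩ := CommGroup.exists_apply_ne_one_of_hasEnoughRootsOfUnity Gal(L/k) k hne
  -- the resolvent of `χ`, nonzero at some `x` by independence of characters
  obtain ⟨x, hx⟩ : ∃ x : L, ∑ g : Gal(L/k), algebraMap k L (χ g⁻¹ : kˣ) * g x ≠ 0 := by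
    by_contra! h0
    have hli := (linearIndependent_monoidHom L L).comp
      (fun g : Gal(L/k) ↦ (g : L →* L)) (fun a b hab ↦ by
        ext y; exact DFunLike.congr_fun hab y)
    have := Fintype.linearIndependent_iff.1 hli (fun g ↦ algebraMap k L (χ g⁻¹ : kˣ)) (by
      ext y; simpa using h0 y) 1
    simp at this
  set v := ∑ g : Gal(L/k), algebraMap k L (χ g⁻¹ : kˣ) * g x with hv
  have hact (σ : Gal(L/k)) : σ v = algebraMap k L (χ σ : kˣ) * v := by
    rw [hv, map_sum, Finset.mul_sum]
    refine Fintype.sum_equiv (Equiv.mulLeft σ) _ _ fun g ↦ ?_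
    simp only [Equiv.coe_mulLeft, map_mul, AlgEquiv.commutes, AlgEquiv.mul_apply, mul_inv_rev,
      Units.val_mul]
    rw [← mul_assoc, mul_left_comm, ← map_mul (algebraMap k L), ← Units.val_mul, ← map_mul]
    simp
  have hmem : v ^ n ∈ (⊥ : IntermediateField k L) := by
    rw [IsGalois.mem_bot_iff_fixed]
    intro σ
    rw [map_pow, hact, mul_pow, ← map_pow, ← Units.val_pow_eq_pow_val, ← map_pow, h]
    simp
  obtain ⟨a, ha⟩ := IntermediateField.mem_bot.1 hmem
  have hvS : v ∈ S := IntermediateField.subset_adjoin _ _ ⟨a, by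
    rintro rfl
    exact hx (pow_eq_zero_iff (NeZero.ne n) |>.1 (by simpa using ha.symm)), ha.symm⟩
  have h1 := (IntermediateField.mem_fixingSubgroup_iff _ _).1 hτ v hvS
  rw [hact, mul_eq_right₀ hx] at h1
  exact hχ (Units.ext ((algebraMap k L).injective (by simpa using h1)))

/-- Characters with values in `ZMod p` separate the points of a commutative group of exponent
dividing `p`. -/
theorem exists_monoidHom_multiplicative_zmod_ne_one {G : Type*} [CommGroup G] {p : ℕ}
    [Fact p.Prime] (h : ∀ g : G, g ^ p = 1) {g : G} (hg : g ≠ 1) :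
    ∃ χ : G →* Multiplicative (ZMod p), χ g ≠ 1 := by
  let := AddCommGroup.zmodModule (G := Additive G) (n := p) fun x ↦ h x.toMul
  by_contra! h0
  refine hg ((Module.forall_dual_apply_eq_zero_iff (ZMod p) (Additive.ofMul g)).1 fun f ↦ ?_)
  exact h0 (AddMonoidHom.toMultiplicativeRight f.toAddMonoidHom)

theorem adjoin_artinSchreier_eq_top_of_pow_eq_one {p : ℕ} [Fact p.Prime] [CharP k p]
    [FiniteDimensional k L] [IsAbelianGalois k L] (h : ∀ σ : Gal(L/k), σ ^ p = 1) :
    IntermediateField.adjoin k {y : L | ∃ x : k, y ^ p - y = algebraMap k L x} = ⊤ := by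
  classical
  have := charP_of_injective_algebraMap (algebraMap k L).injective p
  set S := IntermediateField.adjoin k {y : L | ∃ x : k, y ^ p - y = algebraMap k L x} with hS
  rw [← IsGalois.fixedField_fixingSubgroup S]
  suffices S.fixingSubgroup = ⊥ by rw [this, IntermediateField.fixedField_bot]
  refine (Subgroup.eq_bot_iff_forall _).2 fun τ hτ ↦ ?_
  by_contra hne
  let : CommGroup Gal(L/k) := { mul_comm := (IsMulCommutative.is_comm (M := Gal(L/k))).comm }
  obtain ⟨χ', hχ⟩ := exists_monoidHom_multiplicative_zmod_ne_one h hne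
  set χ : Gal(L/k) → ZMod p := fun g ↦ (χ' g).toAdd with hχdef
  let c : ZMod p →+* L := ZMod.castHom dvd_rfl L
  have hcfix (σ : Gal(L/k)) (t : ZMod p) : σ (c t) = c t :=
    DFunLike.congr_fun (Subsingleton.elim ((σ : L →+* L).comp c) c) t
  obtain ⟨θ, hθ⟩ : ∃ θ : L, ∑ g : Gal(L/k), g θ = 1 := by
    obtain ⟨θ, hθ⟩ := Algebra.trace_surjective k L 1
    exact ⟨θ, by rw [← trace_eq_sum_automorphisms, hθ, map_one]⟩
  -- the additive resolvent, on which `σ` acts as translation by `χ σ`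
  set v := -∑ g : Gal(L/k), c (χ g) * g θ with hv
  have hact (σ : Gal(L/k)) : σ v = v + c (χ σ) := by
    have : σ v = -∑ g : Gal(L/k), c (χ (σ⁻¹ * g)) * g θ := by
      rw [hv, map_neg, map_sum]
      congr 1
      refine Fintype.sum_equiv (Equiv.mulLeft σ) _ _ fun g ↦ ?_
      simp [hcfix]
    rw [this, hv]
    simp only [hχdef, map_mul, map_inv, toAdd_mul, toAdd_inv, map_add, map_neg, add_mul, neg_mul,
      Finset.sum_add_distrib, Finset.sum_neg_distrib, ← Finset.mul_sum, hθ]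
    ring
  have hmem : v ^ p - v ∈ (⊥ : IntermediateField k L) := by
    rw [IsGalois.mem_bot_iff_fixed]
    intro σ
    rw [map_sub, map_pow, hact, add_pow_char, ← map_pow, ZMod.pow_card]
    ring
  obtain ⟨a, ha⟩ := IntermediateField.mem_bot.1 hmem
  have hvS : v ∈ S := IntermediateField.subset_adjoin _ _ ⟨a, ha.symm⟩
  have h1 := (IntermediateField.mem_fixingSubgroup_iff _ _).1 hτ v hvS
  rw [hact, add_eq_left, map_eq_zero] at h1
  exact hχ h1

end Kummer

section KummerInfinite

variable {k Ω : Type*} [Field k] [Field Ω] [Algebra k Ω] [IsGalois k Ω]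

/-- A set `S` generates the maximal abelian extension of exponent `n` if every finite abelian
extension `L` of exponent dividing `n` is generated by the elements of `S` it contains. -/
theorem maxAbelianField_le_adjoin {n : ℕ} (S : Set Ω)
    (hS : ∀ L : IntermediateField k Ω, FiniteDimensional k L → IsAbelianGalois k L →
      (∀ σ : Gal(L/k), σ ^ n = 1) → IntermediateField.adjoin k {y : L | (y : Ω) ∈ S} = ⊤) :
    maxAbelianField k Ω n ≤ IntermediateField.adjoin k S := by
  intro x hx
  set L := IntermediateField.adjoin k {x} with hL
  have hle : L ≤ maxAbelianField k Ω n := by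
    rw [hL, IntermediateField.adjoin_simple_le_iff]; exact hx
  have hfin : FiniteDimensional k L :=
    IntermediateField.adjoin.finiteDimensional (Algebra.IsIntegral.isIntegral x)
  have := hS L hfin (isAbelianGalois_of_le_maxAbelianField hle)
    (pow_eq_one_of_le_maxAbelianField hle)
  have h2 : L ≤ IntermediateField.adjoin k S := by
    have h3 : (IntermediateField.adjoin k {y : L | (y : Ω) ∈ S}).map L.val ≤
        IntermediateField.adjoin k S := by
      rw [IntermediateField.adjoin_map]
      refine IntermediateField.adjoin.mono _ _ _ ?_
      rintro _ ⟨y, hy, rfl⟩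
      exact hy
    rw [this] at h3
    exact fun y hy ↦ h3 ⟨⟨y, hy⟩, trivial, rfl⟩
  exact h2 (IntermediateField.mem_adjoin_simple_self k x)

/-- Kummer theory, for possibly infinite extensions. -/
theorem maxAbelianField_eq_radicalField {n : ℕ} [NeZero n] {ζ : k} (hζ : IsPrimitiveRoot ζ n) :
    maxAbelianField k Ω n = radicalField k Ω n := by
  refine le_antisymm (maxAbelianField_le_adjoin _ fun L _ _ h ↦ ?_)
    (IntermediateField.adjoin_le_iff.2 ?_)
  · rw [← adjoin_roots_eq_top_of_pow_eq_one hζ h]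
    congr 1
    ext y
    exact exists_congr fun x ↦ and_congr_right fun _ ↦
      ⟨fun h ↦ Subtype.ext h, fun h ↦ congrArg Subtype.val h⟩
  · rintro y ⟨x, hx, hy⟩
    have hy0 : y ≠ 0 := by
      rintro rfl
      rw [zero_pow (NeZero.ne n), eq_comm, map_eq_zero] at hy
      exact hx hy
    have key (σ : Gal(Ω/k)) : ∃ t : k, t ^ n = 1 ∧ σ y = algebraMap k Ω t * y := by
      have h1 : (σ y / y) ^ n = 1 := by
        rw [div_pow, ← map_pow, hy, AlgEquiv.commutes, div_self]
        simpa using hx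
      obtain ⟨i, -, hi⟩ := (hζ.map_of_injective (algebraMap k Ω).injective).eq_pow_of_pow_eq_one h1
      refine ⟨ζ ^ i, by rw [← pow_mul, mul_comm, pow_mul, hζ.pow_eq_one, one_pow], ?_⟩
      rw [map_pow, hi, div_mul_cancel₀ _ hy0]
    refine ⟨fun σ τ ↦ ?_, fun σ ↦ ?_⟩
    · obtain ⟨s, -, hs⟩ := key σ
      obtain ⟨t, -, ht⟩ := key τ
      simp only [hs, ht, map_mul, AlgEquiv.commutes]
      ring
    · obtain ⟨s, hs, h⟩ := key σ
      have (m : ℕ) : (σ ^ m) y = algebraMap k Ω s ^ m * y := by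
        induction m with
        | zero => simp
        | succ m ih =>
          rw [pow_succ, AlgEquiv.mul_apply, h, map_mul, ih, AlgEquiv.commutes]; ring
      rw [this, ← map_pow, hs, map_one, one_mul]

/-- Artin-Schreier theory, for possibly infinite extensions. -/
theorem maxAbelianField_eq_artinSchreierField {p : ℕ} [Fact p.Prime] [CharP k p] :
    maxAbelianField k Ω p = artinSchreierField k Ω p := by
  have := charP_of_injective_algebraMap (algebraMap k Ω).injective p
  refine le_antisymm (maxAbelianField_le_adjoin _ fun L _ _ h ↦ ?_)
    (IntermediateField.adjoin_le_iff.2 ?_)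
  · rw [← adjoin_artinSchreier_eq_top_of_pow_eq_one h]
    congr 1
    ext y
    exact exists_congr fun x ↦ ⟨fun h ↦ Subtype.ext h, fun h ↦ congrArg Subtype.val h⟩
  · rintro y ⟨x, hy⟩
    let c : ZMod p →+* Ω := ZMod.castHom dvd_rfl Ω
    have hcfix (σ : Gal(Ω/k)) (t : ZMod p) : σ (c t) = c t :=
      DFunLike.congr_fun (Subsingleton.elim ((σ : Ω →+* Ω).comp c) c) t
    have key (σ : Gal(Ω/k)) : ∃ t : ZMod p, σ y = y + c t := by
      have h1 : (σ y - y) ^ p = σ y - y := by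
        have h2 := congrArg σ hy
        rw [AlgEquiv.commutes, ← hy, map_sub, map_pow] at h2
        rw [sub_pow_char]
        linear_combination h2
      obtain ⟨t, ht⟩ : σ y - y ∈ c.fieldRange := by
        exact bot_le (α := Subfield Ω) ((Subfield.mem_bot_iff_pow_eq_self Ω p).2 h1)
      exact ⟨t, by rw [ht]; ring⟩
    refine ⟨fun σ τ ↦ ?_, fun σ ↦ ?_⟩
    · obtain ⟨s, hs⟩ := key σ
      obtain ⟨t, ht⟩ := key τ
      simp only [hs, ht, map_add, hcfix]
      ring
    · obtain ⟨s, h⟩ := key σ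
      have (m : ℕ) : (σ ^ m) y = y + m * c s := by
        induction m with
        | zero => simp
        | succ m ih =>
          rw [pow_succ, AlgEquiv.mul_apply, h, map_add, ih, hcfix]; push_cast; ring
      rw [this, CharP.cast_eq_zero, zero_mul, add_zero]

end KummerInfinite

/-! ### Finite groups with a normal subgroup of exponent `p` and quotient of exponent `p - 1` -/

section Groups

variable {p : ℕ} [Fact p.Prime]

/-- A solvable group `G` with a subgroup `S` of prime index `p` and trivial core is a group of
affine transformations of the line over `ZMod p`: the last nontrivial term `N` of the derived
series is its own centralizer and has order `p`, so `G ⧸ N` embeds into `(ZMod p)ˣ`. -/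
theorem exists_normal_of_isSolvable_of_index_eq_prime {G : Type*} [Group G] [Finite G]
    [Group.IsSolvable G] (S : Subgroup G) (hS : S.index = p) (hcore : S.normalCore = ⊥) :
    ∃ N : Subgroup G, N.Normal ∧ (∀ a ∈ N, ∀ b ∈ N, a * b = b * a) ∧ (∀ a ∈ N, a ^ p = 1) ∧
      (∀ g, g ^ (p - 1) ∈ N) ∧ ∀ g h : G, g * h * g⁻¹ * h⁻¹ ∈ N := by
  classical
  have hp := (Fact.out : p.Prime)
  obtain ⟨N, hN, hcomm, hne⟩ : ∃ N : Subgroup G, N.Normal ∧ (∀ a ∈ N, ∀ b ∈ N, a * b = b * a) ∧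
      N ≠ ⊥ := by
    have hex : ∃ n, derivedSeries G n = ⊥ := Group.IsSolvable.solvable
    have h0 : Nat.find hex ≠ 0 := by
      intro h
      have h1 := Nat.find_spec hex
      rw [h, derivedSeries_zero] at h1
      have h2 : Subsingleton G := subsingleton_of_forall_eq 1 fun g ↦ by
        have : g ∈ (⊤ : Subgroup G) := trivial
        rwa [h1, Subgroup.mem_bot] at this
      have : S = ⊤ := Subsingleton.elim _ _
      rw [this, Subgroup.index_top] at hS
      exact hp.one_lt.ne hS
    obtain ⟨m, hm⟩ := Nat.exists_eq_succ_of_ne_zero h0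
    refine ⟨derivedSeries G m, derivedSeries_normal G m, fun a ha b hb ↦ ?_,
      Nat.find_min hex (by omega)⟩
    have h1 := Nat.find_spec hex
    rw [hm, Nat.succ_eq_add_one, derivedSeries_succ] at h1
    have h2 := Subgroup.commutator_mem_commutator ha hb
    rw [h1, Subgroup.mem_bot] at h2
    exact commutatorElement_eq_one_iff_mul_comm.1 h2
  have hNS : ¬ N ≤ S := fun h ↦ hne (le_bot_iff.1 (hcore ▸ Subgroup.normal_le_normalCore.2 h))
  have hsup : N ⊔ S = ⊤ := by
    have h1 : (N ⊔ S).index ∣ p := hS ▸ Subgroup.index_dvd_of_le le_sup_right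
    rcases (Nat.dvd_prime hp).1 h1 with h | h
    · exact Subgroup.index_eq_one.1 h
    · have h2 := Subgroup.relIndex_mul_index (le_sup_right : S ≤ N ⊔ S)
      rw [h, hS] at h2
      have h3 : S.relIndex (N ⊔ S) = 1 := Nat.eq_of_mul_eq_mul_right hp.pos (by omega)
      exact absurd (le_sup_left.trans (Subgroup.relIndex_eq_one.1 h3)) hNS
  -- normal subgroups inside `S` are trivial, and normality is tested on `N` and `S` only
  have hdec (g : G) : ∃ n ∈ N, ∃ s ∈ S, n * s = g :=
    Subgroup.mem_sup_of_normal_left.1 (hsup ▸ Subgroup.mem_top g)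
  have htriv (T : Subgroup G) (hTS : T ≤ S) (h1 : ∀ n ∈ N, ∀ t ∈ T, n * t * n⁻¹ ∈ T)
      (h2 : ∀ s ∈ S, ∀ t ∈ T, s * t * s⁻¹ ∈ T) : T = ⊥ := by
    have hT : T.Normal := ⟨fun t ht g ↦ by
      obtain ⟨n, hn, s, hs, rfl⟩ := hdec g
      have := h1 n hn _ (h2 s hs t ht)
      simpa [mul_assoc] using this⟩
    exact le_bot_iff.1 (hcore ▸ Subgroup.normal_le_normalCore.2 hTS)
  have hdisj : N ⊓ S = ⊥ := by
    refine htriv _ inf_le_right (fun n hn t ht ↦ ?_) (fun s hs t ht ↦ ?_)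
    · rwa [hcomm n hn t ht.1, mul_inv_cancel_right]
    · exact ⟨hN.conj_mem t ht.1 s, S.mul_mem (S.mul_mem hs ht.2) (S.inv_mem hs)⟩
  have hcardN : Nat.card N = p := by
    rw [← hS]
    refine (Subgroup.IsComplement'.index_eq_card (Subgroup.isComplement'_of_disjoint_and_mul_eq_univ
      (disjoint_iff.2 hdisj) ?_)).symm
    rw [← Subgroup.normal_mul, hsup, Subgroup.coe_top]
  have hcent (g : G) (hg : ∀ n ∈ N, g * n = n * g) : g ∈ N := by
    have hC := htriv (Subgroup.centralizer N ⊓ S) inf_le_right (fun n hn t ht ↦ by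
        rwa [Subgroup.mem_centralizer_iff.1 ht.1 n hn, mul_inv_cancel_right])
      (fun s hs t ht ↦ ⟨Subgroup.Normal.conj_mem inferInstance t ht.1 s,
        S.mul_mem (S.mul_mem hs ht.2) (S.inv_mem hs)⟩)
    obtain ⟨n, hn, s, hs, rfl⟩ := hdec g
    have : s ∈ Subgroup.centralizer (N : Set G) ⊓ S := by
      refine ⟨Subgroup.mem_centralizer_iff.2 fun m hm ↦ ?_, hs⟩
      have h1 := hg m hm
      rw [mul_assoc, ← mul_assoc m, hcomm m hm n hn, mul_assoc] at h1
      exact (mul_left_cancel h1).symm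
    rw [hC, Subgroup.mem_bot] at this
    rwa [this, mul_one]
  have hcyc : IsCyclic N := isCyclic_of_prime_card hcardN
  let φ : G →* (ZMod (Nat.card N))ˣ :=
    (IsCyclic.mulAutMulEquiv N).toMonoidHom.comp MulAut.conjNormal
  have hker (g : G) (hg : φ g = 1) : g ∈ N := by
    have h1 : MulAut.conjNormal (H := N) g = 1 := (IsCyclic.mulAutMulEquiv N).injective (by
      rw [map_one]; exact hg)
    refine hcent g fun n hn ↦ ?_
    have h2 := congrArg Subtype.val (DFunLike.congr_fun h1 ⟨n, hn⟩)
    rw [MulAut.conjNormal_apply] at h2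
    exact mul_inv_eq_iff_eq_mul.1 h2
  refine ⟨N, hN, hcomm, fun a ha ↦ ?_, fun g ↦ hker _ ?_, fun g h ↦ hker _ ?_⟩
  · have := pow_card_eq_one' (G := N) (x := ⟨a, ha⟩)
    rw [hcardN] at this
    exact congrArg Subtype.val this
  · rw [map_pow]
    have : Fact (Nat.card N).Prime := ⟨hcardN ▸ hp⟩
    conv_lhs => rw [← hcardN]
    exact ZMod.units_pow_card_sub_one_eq_one _ _
  · simp only [map_mul, map_inv]
    rw [mul_comm (φ g), mul_inv_cancel_right, mul_inv_cancel]

/-- Commuting endomorphisms of order dividing `p - 1` of a vector space over `ZMod p` are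
simultaneously diagonalizable; hence a linear form which does not vanish identically does not
vanish at some simultaneous eigenvector. -/
theorem exists_simultaneous_eigenvector {M ι : Type*} [AddCommGroup M] [Module (ZMod p) M]
    (T : ι → Module.End (ZMod p) M) (hT : ∀ i j, T i * T j = T j * T i)
    (hpow : ∀ i, T i ^ (p - 1) = 1) (ev : M →ₗ[ZMod p] ZMod p) {f : M} (hf : ev f ≠ 0)
    (s : Finset ι) : ∃ f : M, ev f ≠ 0 ∧ ∀ i ∈ s, ∃ c : ZMod p, T i f = c • f := by
  classical
  induction s using Finset.induction_on with
  | empty => exact ⟨f, hf, by simp⟩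
  | insert i s _ ih =>
    obtain ⟨f, hf, hs⟩ := ih
    -- the projections of `f` to the eigenspaces of `T i`, up to sign
    let P (c : (ZMod p)ˣ) : Module.End (ZMod p) M :=
      ∑ j ∈ Finset.range (p - 1), ((c⁻¹ : (ZMod p)ˣ) : ZMod p) ^ j • T i ^ j
    have hsum : ∑ c : (ZMod p)ˣ, P c = -1 := by
      have h0 (j : ℕ) : ∑ c : (ZMod p)ˣ, ((c⁻¹ : (ZMod p)ˣ) : ZMod p) ^ j =
          if p - 1 ∣ j then -1 else 0 := by
        have := FiniteField.sum_pow_units (ZMod p) j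
        rw [ZMod.card] at this
        rw [← this]
        exact Fintype.sum_equiv (Equiv.inv _) _ _ fun c ↦ rfl
      simp only [P]
      rw [Finset.sum_comm]
      simp_rw [← Finset.sum_smul, h0]
      rw [Finset.sum_eq_single_of_mem 0 
        (Finset.mem_range.2 (Nat.sub_pos_of_lt (Fact.out : p.Prime).one_lt))]
      · simp
      · intro j hj hj0
        rw [if_neg, zero_smul]
        exact Nat.not_dvd_of_pos_of_lt (Nat.pos_of_ne_zero hj0) (Finset.mem_range.1 hj)
    obtain ⟨c, hc⟩ : ∃ c, ev (P c f) ≠ 0 := by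
      by_contra! h0
      have h1 : ev ((∑ c : (ZMod p)ˣ, P c) f) = 0 := by
        rw [LinearMap.sum_apply, map_sum]
        exact Finset.sum_eq_zero fun c _ ↦ h0 c
      rw [hsum, LinearMap.neg_apply, Module.End.one_apply, map_neg, neg_eq_zero] at h1
      exact hf h1
    refine ⟨P c f, hc, fun j hj ↦ ?_⟩
    rcases Finset.mem_insert.1 hj with rfl | hj
    · refine ⟨c, ?_⟩
      have h1 : (((c⁻¹ : (ZMod p)ˣ) : ZMod p) • T j - 1) * P c = 0 := by
        simp only [P, ← smul_pow]
        rw [mul_geom_sum, smul_pow, hpow, ← Units.val_pow_eq_pow_val,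
          ZMod.units_pow_card_sub_one_eq_one, Units.val_one, one_smul, sub_self]
      have h2 := LinearMap.congr_fun h1 f
      simp only [Module.End.mul_apply, LinearMap.sub_apply, LinearMap.smul_apply,
        Module.End.one_apply, LinearMap.zero_apply, sub_eq_zero] at h2
      rw [← h2, smul_smul, ← Units.val_mul, mul_inv_cancel, Units.val_one, one_smul, h2]
    · obtain ⟨d, hd⟩ := hs j hj
      refine ⟨d, ?_⟩
      have h1 : T j * P c = P c * T j := by
        simp only [P, Finset.mul_sum, Finset.sum_mul, mul_smul_comm, smul_mul_assoc]
        refine Finset.sum_congr rfl fun m _ ↦ ?_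
        rw [(Commute.pow_right (hT j i) m).eq]
      rw [← Module.End.mul_apply, h1, Module.End.mul_apply, hd, map_smul]

/-- A commutative group of exponent `p` on which commuting automorphisms of order dividing
`p - 1` act has enough invariant subgroups of index `p` to separate its points from `1`. -/
theorem exists_invariant_character {V ι : Type*} [CommGroup V] [Finite ι]
    (hV : ∀ v : V, v ^ p = 1) (φ : ι → V →* V) (hφ : ∀ i j v, φ i (φ j v) = φ j (φ i v))
    (hpow : ∀ i v, (φ i)^[p - 1] v = v) {v : V} (hv : v ≠ 1) :
    ∃ χ : V →* Multiplicative (ZMod p), χ v ≠ 1 ∧ ∀ i x, χ x = 1 → χ (φ i x) = 1 := by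
  have := Fintype.ofFinite ι
  let := AddCommGroup.zmodModule (G := Additive V) (n := p) fun x ↦ hV x.toMul
  let ψ (i : ι) : Additive V →ₗ[ZMod p] Additive V :=
    AddMonoidHom.toZModLinearMap p (MonoidHom.toAdditive (φ i))
  let T (i : ι) : Module.End (ZMod p) (Module.Dual (ZMod p) (Additive V)) := (ψ i).dualMap
  have hTapp (i : ι) (f : Module.Dual (ZMod p) (Additive V)) (x : V) :
      T i f (Additive.ofMul x) = f (Additive.ofMul (φ i x)) := rfl
  have hTpow (i : ι) (n : ℕ) (f : Module.Dual (ZMod p) (Additive V)) (x : V) :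
      (T i ^ n) f (Additive.ofMul x) = f (Additive.ofMul ((φ i)^[n] x)) := by
    induction n generalizing x with
    | zero => rfl
    | succ n ih =>
      rw [pow_succ', Module.End.mul_apply, hTapp, ih, Function.iterate_succ_apply]
  obtain ⟨f₀, hf₀⟩ : ∃ f : Module.Dual (ZMod p) (Additive V), f (Additive.ofMul v) ≠ 0 := by
    by_contra! h0
    exact hv ((Module.forall_dual_apply_eq_zero_iff (ZMod p) (Additive.ofMul v)).1 h0)
  obtain ⟨f, hf, h⟩ := exists_simultaneous_eigenvector T
    (fun i j ↦ LinearMap.ext fun f ↦ LinearMap.ext fun x ↦ congrArg f (hφ i j x).symm)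
    (fun i ↦ LinearMap.ext fun f ↦ LinearMap.ext fun x ↦
      (hTpow i _ f x).trans (congrArg f (hpow i x)))
    (LinearMap.applyₗ (Additive.ofMul v)) (f := f₀) hf₀ Finset.univ
  refine ⟨AddMonoidHom.toMultiplicativeRight f.toAddMonoidHom, hf, fun i x hx ↦ ?_⟩
  obtain ⟨c, hc⟩ := h i (Finset.mem_univ i)
  have h1 := LinearMap.congr_fun hc (Additive.ofMul x)
  rw [hTapp] at h1
  have hx' : f (Additive.ofMul x) = 0 := hx
  rw [LinearMap.smul_apply, hx', smul_zero] at h1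
  exact h1

/-- Let `V` be an abelian normal subgroup of exponent `p` with `G ⧸ V` abelian of exponent dividing
`p - 1`. The subgroups of index `p` of `G` separate the elements of `V` from `1`: they include the
products of a `G`-invariant hyperplane of `V` with a complement of `V`. -/
theorem eq_one_of_forall_mem_of_index_eq_prime {G : Type*} [Group G] [Finite G] (V : Subgroup G)
    [V.Normal] (hcomm : ∀ a ∈ V, ∀ b ∈ V, a * b = b * a) (hexp : ∀ a ∈ V, a ^ p = 1)
    (hpow : ∀ g, g ^ (p - 1) ∈ V) (hder : ∀ g h : G, g * h * g⁻¹ * h⁻¹ ∈ V) {v : G} (hv : v ∈ V)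
    (h : ∀ H : Subgroup G, H.index = p → v ∈ H) : v = 1 := by
  classical
  have hp := (Fact.out : p.Prime)
  by_contra hv1
  let : CommGroup V := { mul_comm := fun a b ↦ Subtype.ext (hcomm a a.2 b b.2) }
  have hconj (g : G) (x : V) : ((MulAut.conjNormal g x : V) : G) = g * x * g⁻¹ :=
    MulAut.conjNormal_apply g x
  have hconjV (g : G) (hg : g ∈ V) (x : V) : MulAut.conjNormal g x = x :=
    Subtype.ext (by rw [hconj, hcomm g hg x x.2, mul_inv_cancel_right])
  obtain ⟨χ, hχv, hχ⟩ := exists_invariant_character (ι := G) (V := V) (p := p)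
    (fun x ↦ Subtype.ext (hexp x x.2)) (fun g ↦ (MulAut.conjNormal g).toMonoidHom)
    (fun g h x ↦ by
      change MulAut.conjNormal g (MulAut.conjNormal h x) =
        MulAut.conjNormal h (MulAut.conjNormal g x)
      rw [← MulAut.mul_apply, ← MulAut.mul_apply, ← map_mul, ← map_mul]
      have : g * h = (g * h * g⁻¹ * h⁻¹) * (h * g) := by group
      rw [this, map_mul, MulAut.mul_apply, hconjV _ (hder g h)])
    (fun g x ↦ by
      have (n : ℕ) (y : V) : (fun z : V ↦ MulAut.conjNormal g z)^[n] y =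
          MulAut.conjNormal (g ^ n) y := by
        induction n generalizing y with
        | zero => simp
        | succ n ih =>
          rw [Function.iterate_succ_apply, ih, pow_succ, map_mul, MulAut.mul_apply]
      exact (this (p - 1) x).trans (hconjV _ (hpow g) x))
    (v := ⟨v, hv⟩) (fun h0 ↦ hv1 (congrArg Subtype.val h0))
  let W : Subgroup G := χ.ker.map V.subtype
  have hWV : W ≤ V := by
    rintro _ ⟨x, -, rfl⟩; exact x.2
  have hW (x : V) : (x : G) ∈ W ↔ χ x = 1 := by
    constructor
    · rintro ⟨y, hy, hyx⟩
      rwa [← Subtype.ext hyx]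
    · exact fun hx ↦ ⟨x, hx, rfl⟩
  have hWn : W.Normal := ⟨by
    rintro _ ⟨x, hx, rfl⟩ g
    exact (hW (MulAut.conjNormal g x)).2 (hχ g x hx)⟩
  have hWrel : W.relIndex V = p := by
    have h2 : χ.ker.index = p := by
      rw [Subgroup.index_ker]
      have h3 : Nat.card χ.range ∣ p := by
        have := Subgroup.card_subgroup_dvd_card χ.range
        rwa [Nat.card_congr Multiplicative.toAdd, Nat.card_zmod] at this
      rcases (Nat.dvd_prime hp).1 h3 with h4 | h4
      · have h5 := Subgroup.card_eq_one.1 h4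
        have h6 : χ ⟨v, hv⟩ ∈ χ.range := ⟨_, rfl⟩
        rw [h5, Subgroup.mem_bot] at h6
        exact absurd h6 hχv
      · exact h4
    rwa [Subgroup.relIndex, Subgroup.subgroupOf, Subgroup.comap_map_eq_self_of_injective
      V.subtype_injective]
  have hcop : (Nat.card V).Coprime V.index := by
    have hV : IsPGroup p V := fun x ↦ ⟨1, by rw [pow_one]; exact Subtype.ext (hexp x x.2)⟩
    obtain ⟨n, hn⟩ := IsPGroup.iff_card.1 hV
    rw [hn]
    refine Nat.Coprime.pow_left _ ((Nat.Prime.coprime_iff_not_dvd hp).2 fun hdvd ↦ ?_)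
    obtain ⟨q, hq⟩ := exists_prime_orderOf_dvd_card' (G := G ⧸ V) p hdvd
    have h1 : q ^ (p - 1) = 1 := by
      obtain ⟨g, rfl⟩ := QuotientGroup.mk_surjective q
      rw [← QuotientGroup.mk_pow, QuotientGroup.eq_one_iff]
      exact hpow g
    have h2 := orderOf_dvd_of_pow_eq_one h1
    rw [hq] at h2
    have h3 := Nat.le_of_dvd (Nat.sub_pos_of_lt hp.one_lt) h2
    have := hp.pos
    omega
  obtain ⟨D, hD⟩ := Subgroup.exists_right_complement'_of_coprime hcop
  have hmemW (x : G) (hxV : x ∈ V) (hx : x ∈ W ⊔ D) : x ∈ W := by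
    obtain ⟨w, hw, d, hd, rfl⟩ := Subgroup.mem_sup_of_normal_left.1 hx
    have hdV : d ∈ V := by simpa using V.mul_mem (V.inv_mem (hWV hw)) hxV
    have : d ∈ V ⊓ D := ⟨hdV, hd⟩
    rw [disjoint_iff.1 hD.disjoint, Subgroup.mem_bot] at this
    rwa [this, mul_one]
  have hindex : (W ⊔ D).index = p := by
    have h1 : V ⊓ (W ⊔ D) = W :=
      le_antisymm (fun x hx ↦ hmemW x hx.1 hx.2) (le_inf hWV le_sup_left)
    have h2 : W.relIndex (W ⊔ D) = V.index := by
      have h3 : W ⊔ D ⊔ V = ⊤ := top_le_iff.1 (hD.sup_eq_top ▸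
        sup_le le_sup_right (le_sup_right.trans le_sup_left))
      rw [← Subgroup.relIndex_top_right, ← h3, Subgroup.relIndex_sup_right,
        ← Subgroup.inf_relIndex_right V, h1]
    have h4 := Subgroup.relIndex_mul_index hWV
    rw [← Subgroup.relIndex_mul_index (le_sup_left : W ≤ W ⊔ D), h2, hWrel, mul_comm] at h4
    exact (Nat.eq_of_mul_eq_mul_left (Nat.pos_of_ne_zero V.index_ne_zero_of_finite) h4).symm
  exact hχv ((hW ⟨v, hv⟩).1 (hmemW v hv (h _ hindex)))

end Groups

/-! ### Solvability of the Galois groups of a local field -/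

/-- The endomorphisms of a finite field commute, its unit group being cyclic. -/
theorem ringHom_apply_comm_of_finite {k : Type*} [Field k] [Finite k] (f g : k →+* k) (x : k) :
    f (g x) = g (f x) := by
  rcases eq_or_ne x 0 with rfl | hx
  · simp
  obtain ⟨u, hu⟩ := IsCyclic.exists_generator (α := kˣ)
  have key (f : k →+* k) : ∃ n : ℤ, f (u : k) = (u : k) ^ n := by
    obtain ⟨n, hn⟩ := Subgroup.mem_zpowers_iff.1 (hu (Units.map (f : k →* k) u))
    exact ⟨n, by simpa using (congrArg Units.val hn).symm⟩
  obtain ⟨m, hm⟩ := key f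
  obtain ⟨n, hn⟩ := key g
  obtain ⟨i, hi⟩ := Subgroup.mem_zpowers_iff.1 (hu (Units.mk0 x hx))
  have hxi : x = (u : k) ^ i := by simpa using (congrArg Units.val hi).symm
  simp only [hxi, map_zpow₀, hm, hn, ← zpow_mul]
  ring_nf

section Isometric

variable {L : Type*} [NontriviallyNormedField L] [IsUltrametricDist L]

theorem IsUltrametricDist.norm_sub_lt {a b : L} {r : ℝ} (ha : ‖a‖ < r) (hb : ‖b‖ < r) :
    ‖a - b‖ < r :=
  (sub_eq_add_neg a b ▸ IsUltrametricDist.norm_add_le_max a (-b)).trans_lt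
    (max_lt ha (by rwa [norm_neg]))

theorem IsUltrametricDist.norm_add_lt {a b : L} {r : ℝ} (ha : ‖a‖ < r) (hb : ‖b‖ < r) :
    ‖a + b‖ < r :=
  (IsUltrametricDist.norm_add_le_max a b).trans_lt (max_lt ha hb)

theorem IsUltrametricDist.norm_sum_lt {ι : Type*} (s : Finset ι) {f : ι → L} {r : ℝ} (hr : 0 < r)
    (h : ∀ i ∈ s, ‖f i‖ < r) : ‖∑ i ∈ s, f i‖ < r := by
  classical
  induction s using Finset.induction_on with
  | empty => simpa
  | insert i s hi ih =>
    rw [Finset.sum_insert hi]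
    exact IsUltrametricDist.norm_add_lt (h i (Finset.mem_insert_self i s))
      (ih fun j hj ↦ h j (Finset.mem_insert_of_mem hj))

/-- A natural number prime to the residue characteristic is a unit. -/
theorem norm_natCast_eq_one_of_coprime {p m : ℕ} (hp : ‖(p : L)‖ < 1) (h : m.Coprime p) :
    ‖(m : L)‖ = 1 := by
  refine le_antisymm (IsUltrametricDist.norm_natCast_le_one L m) (not_lt.1 fun hm ↦ ?_)
  have h1 : (m : ℤ) * m.gcdA p + p * m.gcdB p = 1 := by
    rw [← Nat.gcd_eq_gcd_ab, h]; rfl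
  have h2 : (m : L) * (m.gcdA p : ℤ) + p * (m.gcdB p : ℤ) = 1 := by
    exact_mod_cast congrArg (Int.cast : ℤ → L) h1
  have h3 : ‖(1 : L)‖ < 1 := by
    rw [← h2]
    refine IsUltrametricDist.norm_add_lt ?_ ?_ <;> rw [norm_mul]
    · exact mul_lt_one_of_nonneg_of_lt_one_left (norm_nonneg _) hm
        (IsUltrametricDist.norm_intCast_le_one L _)
    · exact mul_lt_one_of_nonneg_of_lt_one_left (norm_nonneg _) hp
        (IsUltrametricDist.norm_intCast_le_one L _)
  simp at h3

/-- Two isometric automorphisms of a locally compact field commute modulo the maximal ideal, the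
residue field being finite. -/
theorem norm_apply_apply_sub_apply_apply_lt_one [ProperSpace L] (f g : L →+* L)
    (hf : ∀ x, ‖f x‖ = ‖x‖) (hg : ∀ x, ‖g x‖ = ‖x‖) {x : L} (hx : ‖x‖ ≤ 1) :
    ‖f (g x) - g (f x)‖ < 1 := by
  let O : ValuationSubring L := (NormedField.valuation (K := L)).valuationSubring
  have hO (y : L) : y ∈ O ↔ ‖y‖ ≤ 1 := by
    simp [O, Valuation.mem_valuationSubring_iff, ← NNReal.coe_le_coe]
  have hres (y : O) : IsLocalRing.residue O y = 0 ↔ ‖(y : L)‖ < 1 := by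
    rw [IsLocalRing.residue_eq_zero_iff, IsLocalRing.mem_maximalIdeal, mem_nonunits_iff,
      ← not_iff_not, not_not, not_lt]
    constructor
    · rintro ⟨u, rfl⟩
      have h1 : ‖((u : O) : L)‖ * ‖((u⁻¹ : Oˣ) : O).1‖ = 1 := by
        rw [← norm_mul, ← norm_one (α := L)]
        exact congrArg norm (congrArg Subtype.val u.mul_inv)
      have h2 := (hO _).1 ((u⁻¹ : Oˣ) : O).2
      have h3 := norm_nonneg ((u : O) : L)
      nlinarith
    · intro h1
      have h0 : (y : L) ≠ 0 := norm_pos_iff.1 (one_pos.trans_le h1)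
      exact IsUnit.of_mul_eq_one ⟨(y : L)⁻¹, (hO _).2 (by
        rw [norm_inv]; exact inv_le_one_of_one_le₀ h1)⟩ (Subtype.ext (mul_inv_cancel₀ h0))
  have hfin : Finite (IsLocalRing.ResidueField O) := by
    obtain ⟨t, ht, htf, hcov⟩ := (isCompact_closedBall (0 : L) 1).finite_cover_balls one_pos
    have htO (y : L) (hy : y ∈ t) : y ∈ O := (hO y).2 (by simpa using ht hy)
    have := htf.to_subtype
    refine Finite.of_surjective (fun y : t ↦ IsLocalRing.residue O ⟨y, htO y y.2⟩) fun z ↦ ?_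
    obtain ⟨z, rfl⟩ := IsLocalRing.residue_surjective z
    have hz : (z : L) ∈ Metric.closedBall (0 : L) 1 := by simpa using (hO z).1 z.2
    obtain ⟨y, hy, hzy⟩ := Set.mem_iUnion₂.1 (hcov hz)
    refine ⟨⟨y, hy⟩, ?_⟩
    rw [← sub_eq_zero, ← map_sub, hres]
    simpa [dist_eq_norm, norm_sub_rev] using hzy
  let r (f : L →+* L) (hf : ∀ x, ‖f x‖ = ‖x‖) : O →+* O :=
    f.restrict O O fun y hy ↦ (hO _).2 ((hf y).trans_le ((hO y).1 hy))
  have hloc (f : L →+* L) (hf : ∀ x, ‖f x‖ = ‖x‖) : IsLocalHom (r f hf) := ⟨fun y hy ↦ by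
    by_contra h
    have h1 := (hres y).1 ((IsLocalRing.residue_eq_zero_iff _).2 h)
    exact ((IsLocalRing.residue_eq_zero_iff _).1 ((hres (r f hf y)).2 ((hf _).trans_lt h1))) hy⟩
  have := hloc f hf
  have := hloc g hg
  have h1 := ringHom_apply_comm_of_finite (IsLocalRing.ResidueField.map (r f hf))
    (IsLocalRing.ResidueField.map (r g hg)) (IsLocalRing.residue O ⟨x, (hO x).2 hx⟩)
  simp only [IsLocalRing.ResidueField.map_residue] at h1
  rw [← sub_eq_zero, ← map_sub, hres] at h1
  exact h1

variable {G : Type*} [Group G] [MulSemiringAction G L]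

/-- The inertia group: the elements acting trivially modulo the maximal ideal. -/
def inertiaSubgroup (hG : ∀ (g : G) (x : L), ‖g • x‖ = ‖x‖) : Subgroup G where
  carrier := {g | ∀ x : L, ‖x‖ ≤ 1 → ‖g • x - x‖ < 1}
  one_mem' x _ := by simp
  mul_mem' {a b} ha hb x hx := by
    have : (a * b) • x - x = (a • (b • x) - b • x) + (b • x - x) := by rw [mul_smul]; ring
    rw [this]
    exact IsUltrametricDist.norm_add_lt (ha _ ((hG b x).trans_le hx)) (hb x hx)
  inv_mem' {a} ha x hx := by
    rw [norm_sub_rev, ← hG a, smul_sub, smul_inv_smul]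
    exact ha x hx

/-- The wild inertia group: the elements which move every nonzero element `x` by less than `x`. -/
def wildInertiaSubgroup (hG : ∀ (g : G) (x : L), ‖g • x‖ = ‖x‖) : Subgroup G where
  carrier := {g | ∀ x : L, x ≠ 0 → ‖g • x - x‖ < ‖x‖}
  one_mem' x hx := by simpa using hx
  mul_mem' {a b} ha hb x hx := by
    have : (a * b) • x - x = (a • (b • x) - b • x) + (b • x - x) := by rw [mul_smul]; ring
    rw [this]
    refine IsUltrametricDist.norm_add_lt ?_ (hb x hx)
    rw [← hG b x]
    exact ha _ ((smul_ne_zero_iff_ne b).2 hx)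
  inv_mem' {a} ha x hx := by
    rw [norm_sub_rev, ← hG a, smul_sub, smul_inv_smul]
    exact ha x hx

omit [IsUltrametricDist L] in
/-- With `x = h g y`, the displacement of `x` by the commutator of `g` and `h` measures how far `g`
and `h` are from commuting on `y`. -/
theorem exists_commutator_smul_sub_eq (g h : G) (x : L) :
    ∃ y : L, x = h • g • y ∧ (g * h * g⁻¹ * h⁻¹) • x - x = g • h • y - h • g • y := by
  refine ⟨(h * g)⁻¹ • x, ?_, ?_⟩
  · rw [← mul_smul, smul_inv_smul]
  · rw [← mul_smul h g, smul_inv_smul, ← mul_smul, ← mul_smul]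
    congr 2
    group

theorem commutator_le_inertiaSubgroup [ProperSpace L] (hG : ∀ (g : G) (x : L), ‖g • x‖ = ‖x‖) :
    commutator G ≤ inertiaSubgroup hG := by
  rw [commutator_def, Subgroup.commutator_le]
  intro g _ h _ x hx
  obtain ⟨y, rfl, hy⟩ := exists_commutator_smul_sub_eq g h x
  rw [hG, hG] at hx
  rw [commutatorElement_def, hy]
  exact norm_apply_apply_sub_apply_apply_lt_one (MulSemiringAction.toRingHom G L g)
    (MulSemiringAction.toRingHom G L h) (hG g) (hG h) hx

/-- The map `g ↦ g x / x` modulo the maximal ideal is a homomorphism on inertia with values in a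
commutative group, so it kills commutators. -/
theorem commutator_inertiaSubgroup_le (hG : ∀ (g : G) (x : L), ‖g • x‖ = ‖x‖) :
    ⁅inertiaSubgroup hG, inertiaSubgroup hG⁆ ≤ wildInertiaSubgroup hG := by
  rw [Subgroup.commutator_le]
  intro g hg h hh x hx
  obtain ⟨y, rfl, hy⟩ := exists_commutator_smul_sub_eq g h x
  rw [smul_ne_zero_iff_ne, smul_ne_zero_iff_ne] at hx
  rw [commutatorElement_def, hy, hG, hG]
  set a := g • y / y with ha
  set b := h • y / y with hb
  have hna : ‖a‖ = 1 := by rw [ha, norm_div, hG, div_self (norm_ne_zero_iff.2 hx)]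
  have hnb : ‖b‖ = 1 := by rw [hb, norm_div, hG, div_self (norm_ne_zero_iff.2 hx)]
  have hga : g • y = a * y := by rw [ha, div_mul_cancel₀ _ hx]
  have hhb : h • y = b * y := by rw [hb, div_mul_cancel₀ _ hx]
  have : g • h • y - h • g • y = ((g • b - b) * a - (h • a - a) * b) * y := by
    rw [hhb, hga, smul_mul', smul_mul', hga, hhb]; ring
  rw [this, norm_mul]
  refine mul_lt_of_lt_one_left (norm_pos_iff.2 hx) (IsUltrametricDist.norm_sub_lt ?_ ?_)
  · rw [norm_mul, hna, mul_one]; exact hg b hnb.le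
  · rw [norm_mul, hnb, mul_one]; exact hh a hna.le

/-- An element `g` of prime order `ℓ` different from the residue characteristic is not wild: with
`z = g x - x` one has `∑ i < ℓ, g ^ i z = 0`, whereas all `g ^ i z` would be close to `z`. -/
theorem isPGroup_wildInertiaSubgroup [Finite G] [FaithfulSMul G L]
    (hG : ∀ (g : G) (x : L), ‖g • x‖ = ‖x‖) {p : ℕ} [Fact p.Prime] (hp : ‖(p : L)‖ < 1) :
    IsPGroup p (wildInertiaSubgroup hG) := by
  have hcard := Nat.eq_prime_pow_of_unique_prime_dvd (n := Nat.card (wildInertiaSubgroup hG))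
    (p := p) Nat.card_pos.ne' ?_
  · exact IsPGroup.of_card hcard
  intro l hl hdvd
  by_contra hlp
  have := Fact.mk hl
  obtain ⟨⟨g, hg⟩, hord⟩ := exists_prime_orderOf_dvd_card' l hdvd
  rw [Subgroup.orderOf_mk] at hord
  have hnl : ‖(l : L)‖ = 1 :=
    norm_natCast_eq_one_of_coprime hp ((Nat.coprime_primes hl Fact.out).2 hlp)
  have h1 : g = 1 := by
    refine FaithfulSMul.eq_of_smul_eq_smul (α := L) fun x ↦ ?_
    rw [one_smul]
    by_contra hx
    set z := g • x - x with hz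
    have hz0 : z ≠ 0 := sub_ne_zero.2 hx
    have hsum : ∑ i ∈ Finset.range l, g ^ i • z = 0 := by
      have (i : ℕ) : g ^ i • z = g ^ (i + 1) • x - g ^ i • x := by
        rw [hz, smul_sub, pow_succ, mul_smul]
      simp only [this]
      rw [Finset.sum_range_sub (fun i ↦ g ^ i • x), ← hord, pow_orderOf_eq_one]
      simp
    have hlt : ‖∑ i ∈ Finset.range l, (g ^ i • z - z)‖ < ‖z‖ :=
      IsUltrametricDist.norm_sum_lt _ (norm_pos_iff.2 hz0) fun i _ ↦
        (wildInertiaSubgroup hG).pow_mem hg i z hz0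
    rw [Finset.sum_sub_distrib, hsum, zero_sub, norm_neg, Finset.sum_const, Finset.card_range,
      nsmul_eq_mul, norm_mul, hnl, one_mul] at hlt
    exact lt_irrefl _ hlt
  rw [h1, orderOf_one] at hord
  exact hl.one_lt.ne hord

/-- A finite group of isometric automorphisms of a locally compact ultrametric field is
solvable. -/
theorem isSolvable_of_isometric [ProperSpace L] [Finite G] [FaithfulSMul G L]
    (hG : ∀ (g : G) (x : L), ‖g • x‖ = ‖x‖) {p : ℕ} [Fact p.Prime] (hp : ‖(p : L)‖ < 1) :
    Group.IsSolvable G := by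
  have hle : derivedSeries G 2 ≤ wildInertiaSubgroup hG := by
    rw [derivedSeries_succ, derivedSeries_one]
    exact (Subgroup.commutator_mono (commutator_le_inertiaSubgroup hG)
      (commutator_le_inertiaSubgroup hG)).trans (commutator_inertiaSubgroup_le hG)
  have hP : IsPGroup p (derivedSeries G 2) := (isPGroup_wildInertiaSubgroup hG hp).to_le hle
  have := hP.isNilpotent
  have := derivedSeries_normal G 2
  refine (Group.isSolvable_iff_subgroup_quotient (derivedSeries G 2)).2 ⟨inferInstance, ⟨2, ?_⟩⟩
  rw [← map_derivedSeries_eq (QuotientGroup.mk'_surjective (derivedSeries G 2)),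
    Subgroup.map_eq_bot_iff, QuotientGroup.ker_mk']

end Isometric

/-- The finite Galois groups of a local field are solvable, acting isometrically for the spectral
norm. -/
theorem isSolvable_gal {F L : Type*} [NontriviallyNormedField F] [IsUltrametricDist F]
    [ProperSpace F] [Field L] [Algebra F L] [FiniteDimensional F L] {p : ℕ} [Fact p.Prime]
    (hp : ‖(p : F)‖ < 1) : Group.IsSolvable Gal(L/F) := by
  let : NontriviallyNormedField L := spectralNorm.nontriviallyNormedField F L
  have hn (x : L) : ‖x‖ = spectralNorm F L x := rfl
  have : IsUltrametricDist L :=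
    IsUltrametricDist.isUltrametricDist_of_isNonarchimedean_norm isNonarchimedean_spectralNorm
  let : NormedAlgebra F L := spectralNorm.normedAlgebra F L
  have : ProperSpace L := FiniteDimensional.proper F L
  refine isSolvable_of_isometric (L := L) (G := Gal(L/F)) (fun g x ↦ ?_) (p := p) ?_
  · rw [hn, hn]
    exact (spectralNorm_eq_of_equiv g x).symm
  · rw [hn, ← map_natCast (algebraMap F L), spectralNorm_extends]
    exact hp

/-! ### The polynomials `X ^ p - a * X - a` -/

section Estimates

variable {L : Type*} [NontriviallyNormedField L] [IsUltrametricDist L] {p : ℕ}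

theorem norm_pow_eq_of_pow_eq_mul_add (hp : 1 < p) {a x : L} (ha : ‖a‖ < 1)
    (hx : x ^ p = a * x + a) : ‖x‖ ^ p = ‖a‖ := by
  have h1 : ‖x‖ ^ p = ‖a‖ * ‖x + 1‖ := by rw [← norm_pow, hx, ← norm_mul]; ring_nf
  have hx1 : ‖x‖ < 1 := by
    by_contra! h
    have h2 : ‖x + 1‖ ≤ ‖x‖ :=
      (IsUltrametricDist.norm_add_le_max x 1).trans (max_le le_rfl (by simpa using h))
    have h3 : ‖x‖ ^ 1 ≤ ‖x‖ ^ p := pow_le_pow_right₀ h hp.le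
    have := norm_nonneg a
    nlinarith
  have h2 : ‖x + 1‖ = 1 := by
    rw [IsUltrametricDist.norm_add_eq_max_of_norm_ne_norm (by rw [norm_one]; exact hx1.ne),
      norm_one, max_eq_right hx1.le]
  rw [h1, h2, mul_one]

/-- The difference of two roots of `X ^ p - a * X - a` is close to a `(p - 1)`-th root of `a`. -/
theorem norm_sub_pow_sub_lt (hp : p.Prime) {a x y : L} (ha : ‖a‖ < 1) (hxy : x ≠ y)
    (hx : x ^ p = a * x + a) (hy : y ^ p = a * y + a) (hpy : ‖(p : L)‖ < ‖y‖) :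
    ‖(x - y) ^ (p - 1) - a‖ < ‖a‖ := by
  have hxa := norm_pow_eq_of_pow_eq_mul_add hp.one_lt ha hx
  have hya := norm_pow_eq_of_pow_eq_mul_add hp.one_lt ha hy
  have hxy' : ‖x‖ = ‖y‖ := (pow_left_inj₀ (norm_nonneg _) (norm_nonneg _) hp.ne_zero).1
    (hxa.trans hya.symm)
  set z := x - y with hz
  have hz0 : z ≠ 0 := sub_ne_zero.2 hxy
  have hzy : ‖z‖ ≤ ‖y‖ := by
    rw [hz, sub_eq_add_neg]
    refine (IsUltrametricDist.norm_add_le_max x (-y)).trans (max_le hxy'.le ?_)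
    rw [norm_neg]
  have hadd := add_pow_prime_eq hp y z
  set S := ∑ k ∈ Finset.Ioo 0 p, y ^ (k - 1) * z ^ (p - k - 1) * ((p.choose k / p : ℕ) : L) with hS
  have hyz : y + z = x := by rw [hz]; ring
  rw [hyz, hx, hy] at hadd
  have hzp : z ^ p = z ^ (p - 1) * z := by rw [← pow_succ, Nat.sub_add_cancel hp.pos]
  have h1 : z ^ (p - 1) - a = -(p * y * S) := by
    refine mul_right_cancel₀ hz0 ?_
    linear_combination (-1 : L) * hadd - hzp + a * hyz
  have hSn : ‖S‖ ≤ ‖y‖ ^ (p - 2) := by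
    refine IsUltrametricDist.norm_sum_le_of_forall_le_of_nonneg (by positivity) fun k hk ↦ ?_
    rw [Finset.mem_Ioo] at hk
    rw [norm_mul, norm_mul, norm_pow, norm_pow]
    calc ‖y‖ ^ (k - 1) * ‖z‖ ^ (p - k - 1) * ‖((p.choose k / p : ℕ) : L)‖
        ≤ ‖y‖ ^ (k - 1) * ‖y‖ ^ (p - k - 1) * 1 := by
          gcongr
          exact IsUltrametricDist.norm_natCast_le_one L _
      _ = ‖y‖ ^ (p - 2) := by
          rw [mul_one, ← pow_add]; congr 1; omega
  rw [h1, norm_neg, norm_mul, norm_mul, ← hya]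
  have hy0 : 0 < ‖y‖ := (norm_nonneg _).trans_lt hpy
  calc ‖(p : L)‖ * ‖y‖ * ‖S‖ ≤ ‖(p : L)‖ * ‖y‖ * ‖y‖ ^ (p - 2) := by gcongr
    _ < ‖y‖ * ‖y‖ * ‖y‖ ^ (p - 2) := by gcongr
    _ = ‖y‖ ^ p := by
      have := hp.two_le
      rw [← pow_two, ← pow_add]; congr 1; omega

/-- Roots of unity of order prime to the residue characteristic are distinct modulo the maximal
ideal. -/
theorem eq_one_of_pow_eq_one_of_norm_sub_one_lt {m : ℕ} (hm : ‖(m : L)‖ = 1) {t : L}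
    (ht : t ^ m = 1) (h : ‖t - 1‖ < 1) : t = 1 := by
  by_contra ht1
  have h1 (i : ℕ) : ‖t ^ i - 1‖ < 1 := by
    induction i with
    | zero => simp
    | succ i ih =>
      have : t ^ (i + 1) - 1 = (t ^ i - 1) + (t ^ i - 1) * (t - 1) + (t - 1) := by ring
      rw [this]
      refine IsUltrametricDist.norm_add_lt (IsUltrametricDist.norm_add_lt ih ?_) h
      rw [norm_mul]
      exact mul_lt_one_of_nonneg_of_lt_one_left (norm_nonneg _) ih h.le
  have h2 : ∑ i ∈ Finset.range m, t ^ i = 0 := by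
    refine (mul_eq_zero.1 (?_ : _ * (t - 1) = 0)).resolve_right (sub_ne_zero.2 ht1)
    rw [geom_sum_mul, ht, sub_self]
  have h3 := IsUltrametricDist.norm_sum_lt (Finset.range m) one_pos fun i _ ↦ h1 i
  rw [Finset.sum_sub_distrib, h2, zero_sub, norm_neg] at h3
  simp [hm] at h3

/-- A variant of Krasner's lemma: an isometry fixing the `m`-th roots of unity and an approximate
`m`-th root of `a` fixes the `m`-th roots of `a`. -/
theorem apply_eq_self_of_norm_pow_sub_lt {m : ℕ} (hm0 : 0 < m) (hm : ‖(m : L)‖ = 1) {ζ : L}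
    (hζ : IsPrimitiveRoot ζ m) (σ : L →+* L) (hσ : ∀ x, ‖σ x‖ = ‖x‖)
    (hσζ : ∀ t : L, t ^ m = 1 → σ t = t) {a c y : L} (ha : σ a = a) (hc : c ^ m = a)
    (hy : σ y = y) (hya : ‖y ^ m - a‖ < ‖a‖) : σ c = c := by
  have ha0 : a ≠ 0 := norm_pos_iff.1 ((norm_nonneg _).trans_lt hya)
  have hc0 : c ≠ 0 := by rintro rfl; rw [zero_pow hm0.ne'] at hc; exact ha0 hc.symm
  obtain ⟨t, ht, hlt⟩ : ∃ t : L, t ^ m = 1 ∧ ‖y / c - t‖ < 1 := by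
    by_contra! h
    have h1 := congrArg (Polynomial.eval (y / c)) (Polynomial.X_pow_sub_one_eq_prod hm0 hζ)
    rw [Polynomial.eval_prod] at h1
    simp only [Polynomial.eval_sub, Polynomial.eval_pow, Polynomial.eval_X, Polynomial.eval_one,
      Polynomial.eval_C] at h1
    have h2 : ‖(y / c) ^ m - 1‖ < 1 := by
      have : (y / c) ^ m - 1 = (y ^ m - a) / a := by
        rw [div_pow, hc, sub_div, div_self ha0]
      rw [this, norm_div]
      exact (div_lt_one (norm_pos_iff.2 ha0)).2 hya
    rw [h1, norm_prod] at h2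
    refine h2.not_ge (Finset.prod_induction _ (1 ≤ ·) (fun _ _ ↦ one_le_mul_of_one_le_of_one_le)
      le_rfl fun t ht ↦ h t ?_)
    exact (Polynomial.mem_nthRootsFinset hm0 1).1 ht
  have ht0 : t ≠ 0 := by rintro rfl; rw [zero_pow hm0.ne'] at ht; exact zero_ne_one ht
  have hd0 : t * c ≠ 0 := mul_ne_zero ht0 hc0
  have hcd : ‖t * c‖ = ‖c‖ := by
    have : ‖t‖ = 1 := (pow_eq_one_iff_of_nonneg (norm_nonneg t) hm0.ne').1 (by
      rw [← norm_pow, ht, norm_one])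
    rw [norm_mul, this, one_mul]
  have h1 : ‖y - t * c‖ < ‖t * c‖ := by
    have : y - t * c = (y / c - t) * c := by rw [sub_mul, div_mul_cancel₀ _ hc0]
    rw [this, norm_mul, hcd]
    exact mul_lt_of_lt_one_left (norm_pos_iff.2 hc0) hlt
  have h2 : ‖y - σ (t * c)‖ < ‖t * c‖ := by
    rw [← hσ (y - t * c), map_sub, hy] at h1
    exact h1
  have h3 : ‖σ (t * c) / (t * c) - 1‖ < 1 := by
    have : σ (t * c) / (t * c) - 1 = ((y - t * c) - (y - σ (t * c))) / (t * c) := by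
      rw [div_sub_one hd0]; ring_nf
    rw [this, norm_div, div_lt_one (norm_pos_iff.2 hd0)]
    exact IsUltrametricDist.norm_sub_lt h1 h2
  have h4 : (σ (t * c) / (t * c)) ^ m = 1 := by
    rw [div_pow, ← map_pow, mul_pow, ht, hc, one_mul, ha, div_self ha0]
  have h5 := eq_one_of_pow_eq_one_of_norm_sub_one_lt hm h4 h3
  rw [div_eq_one_iff_eq hd0, map_mul, hσζ t ht] at h5
  exact mul_left_cancel₀ ht0 h5

end Estimates

section Irreducible

open Polynomial

theorem mem_compositumOfDegree {k Ω : Type*} {p : ℕ} [Field k] [Field Ω] [Algebra k Ω]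
    [IsGalois k Ω] {x : Ω} (hx : (minpoly k x).natDegree = p) : x ∈ compositumOfDegree k Ω p := by
  have hle : IntermediateField.adjoin k {x} ≤ compositumOfDegree k Ω p :=
    le_sSup ⟨inferInstance, by
      rw [IntermediateField.adjoin.finrank (Algebra.IsIntegral.isIntegral x), hx]⟩
  exact hle (IntermediateField.mem_adjoin_simple_self k x)

theorem separable_X_pow_sub_C_mul_X_sub_C {F : Type*} [Field F] {p : ℕ} [Fact p.Prime] {a : F}
    (h : Irreducible (X ^ p - C a * X - C a : F[X])) :
    (X ^ p - C a * X - C a : F[X]).Separable := by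
  have hp := (Fact.out : p.Prime)
  rw [separable_iff_derivative_ne_zero h]
  intro h0
  have h1 : derivative (X ^ p - C a * X - C a : F[X]) = C (p : F) * X ^ (p - 1) - C a := by
    simp [derivative_X_pow]
  have h2 := congrArg (Polynomial.eval 0) h0
  rw [h1] at h2
  have ha : a = 0 := by simpa [(Nat.sub_pos_of_lt hp.one_lt).ne'] using h2
  rw [ha, C_0, zero_mul, sub_zero, sub_zero] at h
  exact not_irreducible_pow hp.ne_one h

variable {F : Type*} [NontriviallyNormedField F] [IsUltrametricDist F] [CompleteSpace F] {p : ℕ}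
  [Fact p.Prime]

omit [IsUltrametricDist F] [CompleteSpace F] [Fact p.Prime] in
theorem natDegree_X_pow_sub_C_mul_X_sub_C (hp : 1 < p) (a : F) :
    (X ^ p - C a * X - C a : F[X]).natDegree = p ∧ (X ^ p - C a * X - C a : F[X]).Monic := by
  have h1 : (C a * X + C a : F[X]).degree < (p : ℕ) :=
    degree_linear_le.trans_lt (by exact_mod_cast hp)
  have h2 : (X ^ p - C a * X - C a : F[X]) = X ^ p - (C a * X + C a) := by ring
  rw [h2]
  exact ⟨natDegree_eq_of_degree_eq_some (by
    rw [degree_sub_eq_left_of_degree_lt (by rwa [degree_X_pow]), degree_X_pow]), monic_X_pow_sub h1⟩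

/-- If the valuation of `a` is positive and prime to `p`, a root of `X ^ p - a * X - a` has
valuation `n / p` with `n` prime to `p`, so its degree is divisible by `p`. -/
theorem irreducible_X_pow_sub_C_mul_X_sub_C {π : F} (hπ0 : 0 < ‖π‖) (hπ1 : ‖π‖ < 1)
    (hπ : ∀ x : F, x ≠ 0 → ∃ k : ℤ, ‖x‖ = ‖π‖ ^ k) {n : ℕ} (hn0 : 0 < n) (hnp : n < p) {a : F}
    (ha : ‖a‖ = ‖π‖ ^ n) : Irreducible (X ^ p - C a * X - C a : F[X]) := by
  have hp := (Fact.out : p.Prime)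
  obtain ⟨hdeg, hmonic⟩ := natDegree_X_pow_sub_C_mul_X_sub_C hp.one_lt a
  set f := (X ^ p - C a * X - C a : F[X]) with hf
  obtain ⟨x, hx⟩ := IsAlgClosed.exists_aeval_eq_zero (AlgebraicClosure F) f (by
    rw [degree_eq_natDegree hmonic.ne_zero, hdeg]; exact_mod_cast hp.ne_zero)
  have hx' : x ^ p = algebraMap F _ a * x + algebraMap F _ a := by
    have : x ^ p - algebraMap F _ a * x - algebraMap F _ a = 0 := by simpa [hf] using hx
    linear_combination this
  have hxi : IsIntegral F x := Algebra.IsIntegral.isIntegral x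
  let : NontriviallyNormedField (AlgebraicClosure F) :=
    spectralNorm.nontriviallyNormedField F (AlgebraicClosure F)
  have hnorm (x : AlgebraicClosure F) : ‖x‖ = spectralNorm F _ x := rfl
  have : IsUltrametricDist (AlgebraicClosure F) :=
    IsUltrametricDist.isUltrametricDist_of_isNonarchimedean_norm isNonarchimedean_spectralNorm
  have hna : ‖algebraMap F (AlgebraicClosure F) a‖ = ‖a‖ := spectralNorm_extends a
  have ha1 : ‖a‖ < 1 := ha ▸ pow_lt_one₀ hπ0.le hπ1 hn0.ne'
  have h1 := norm_pow_eq_of_pow_eq_mul_add hp.one_lt (hna.trans_lt ha1) hx'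
  rw [hna] at h1
  set d := (minpoly F x).natDegree with hd
  have hd0 : d ≠ 0 := (minpoly.natDegree_pos hxi).ne'
  have h2 : ‖x‖ ^ d = ‖(minpoly F x).coeff 0‖ := by
    rw [hnorm, spectralNorm.spectralNorm_eq_norm_coeff_zero_rpow, one_div,
      Real.rpow_inv_natCast_pow (norm_nonneg _) hd0]
  have hx0 : x ≠ 0 := by
    rintro rfl
    rw [norm_zero, zero_pow hp.ne_zero, ha] at h1
    exact (pow_pos hπ0 n).ne h1
  obtain ⟨k, hk⟩ := hπ _ (minpoly.coeff_zero_ne_zero hxi hx0)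
  have h3 : ‖π‖ ^ ((n * d : ℕ) : ℤ) = ‖π‖ ^ (k * p) := by
    rw [zpow_mul, ← hk, ← h2, zpow_natCast, zpow_natCast, pow_mul, ← ha, ← h1, ← pow_mul,
      ← pow_mul, mul_comm]
  have h4 := zpow_right_injective₀ hπ0 hπ1.ne h3
  have h5 : p ∣ n * d := Int.natCast_dvd_natCast.1 ⟨k, by rw [mul_comm (p : ℤ)]; exact h4⟩
  have h6 : p ∣ d :=
    (Nat.Coprime.dvd_of_dvd_mul_left (Nat.coprime_of_lt_prime hn0.ne' hnp hp) h5)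
  have h7 : minpoly F x = f := by
    refine (eq_of_monic_of_dvd_of_natDegree_le (minpoly.monic hxi) hmonic
      (minpoly.dvd F x hx) ?_).symm
    rw [hdeg]
    exact Nat.le_of_dvd (Nat.pos_of_ne_zero hd0) h6
  exact h7 ▸ minpoly.irreducible hxi

end Irreducible

section InSepClosure

open Polynomial

variable {F : Type*} [NontriviallyNormedField F] [IsUltrametricDist F] [CompleteSpace F] {p : ℕ}
  [Fact p.Prime] {Ω : Type*} [Field Ω] [Algebra F Ω] [IsSepClosure F Ω]

/-- The splitting field of `X ^ p - a * X - a` contains the `(p - 1)`-th roots of `a`. -/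
theorem mem_compositumOfDegree_of_pow_eq (hpF : ‖(p : F)‖ < 1) {ζ : F}
    (hζ : IsPrimitiveRoot ζ (p - 1)) {π : F} (hπ0 : 0 < ‖π‖) (hπ1 : ‖π‖ < 1)
    (hπ : ∀ x : F, x ≠ 0 → ∃ k : ℤ, ‖x‖ = ‖π‖ ^ k) {n : ℕ} (hn0 : 0 < n) (hnp : n < p) {a : F}
    (ha : ‖a‖ = ‖π‖ ^ n) {c : Ω} (hc : c ^ (p - 1) = algebraMap F Ω a) :
    c ∈ compositumOfDegree F Ω p := by
  have hp := (Fact.out : p.Prime)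
  have : IsSepClosed Ω := IsSepClosure.sep_closed F
  have : IsGalois F Ω := inferInstance
  obtain ⟨hdeg, hmonic⟩ := natDegree_X_pow_sub_C_mul_X_sub_C hp.one_lt a
  have hirr := irreducible_X_pow_sub_C_mul_X_sub_C hπ0 hπ1 hπ hn0 hnp ha
  set f := (X ^ p - C a * X - C a : F[X]) with hf
  have hsep : f.Separable := separable_X_pow_sub_C_mul_X_sub_C hirr
  have hcard := card_rootSet_eq_natDegree hsep
    (IsSepClosed.splits_codomain (f := algebraMap F Ω) f hsep)
  rw [hdeg] at hcard
  obtain ⟨⟨x, hx⟩, ⟨y, hy⟩, hxy⟩ := Fintype.one_lt_card_iff.1 (hcard ▸ hp.one_lt)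
  have hxy' : x ≠ y := fun h ↦ hxy (Subtype.ext h)
  have hroot (x : Ω) (hx : x ∈ f.rootSet Ω) :
      x ^ p = algebraMap F Ω a * x + algebraMap F Ω a ∧ x ∈ compositumOfDegree F Ω p := by
    have h0 := (mem_rootSet.1 hx).2
    refine ⟨?_, mem_compositumOfDegree ?_⟩
    · have : x ^ p - algebraMap F Ω a * x - algebraMap F Ω a = 0 := by simpa [hf] using h0
      linear_combination this
    · rw [← minpoly.eq_of_irreducible_of_monic hirr h0 hmonic, hdeg]
  obtain ⟨hxp, hxC⟩ := hroot x hx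
  obtain ⟨hyp, hyC⟩ := hroot y hy
  let : NontriviallyNormedField Ω := spectralNorm.nontriviallyNormedField F Ω
  have hnorm (x : Ω) : ‖x‖ = spectralNorm F _ x := rfl
  have : IsUltrametricDist Ω :=
    IsUltrametricDist.isUltrametricDist_of_isNonarchimedean_norm isNonarchimedean_spectralNorm
  have hext (x : F) : ‖algebraMap F Ω x‖ = ‖x‖ := spectralNorm_extends x
  have ha1 : ‖algebraMap F Ω a‖ < 1 := by
    rw [hext, ha]; exact pow_lt_one₀ hπ0.le hπ1 hn0.ne'
  have hpΩ : ‖(p : Ω)‖ < 1 := by rwa [← map_natCast (algebraMap F Ω), hext]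
  have hpy : ‖(p : Ω)‖ < ‖y‖ := by
    have h1 : ‖(p : Ω)‖ ≤ ‖π‖ := by
      rw [← map_natCast (algebraMap F Ω), hext]
      rcases eq_or_ne (p : F) 0 with h | h
      · rw [h, norm_zero]; exact hπ0.le
      · obtain ⟨k, hk⟩ := hπ _ h
        rw [hk] at hpF ⊢
        have hk1 : 0 < k := by
          by_contra! hk0
          exact hpF.not_ge (one_le_zpow_of_nonpos₀ hπ0 hπ1.le hk0)
        calc ‖π‖ ^ k ≤ ‖π‖ ^ (1 : ℤ) := zpow_le_zpow_right_of_le_one₀ hπ0 hπ1.le hk1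
          _ = ‖π‖ := zpow_one _
    -- the roots have norm `‖π‖ ^ (n / p)`, which exceeds `‖π‖`
    refine h1.trans_lt (lt_of_pow_lt_pow_left₀ p (norm_nonneg _) ?_)
    rw [norm_pow_eq_of_pow_eq_mul_add hp.one_lt ha1 hyp, hext, ha]
    exact pow_lt_pow_right_of_lt_one₀ hπ0 hπ1 hnp
  have hlt := norm_sub_pow_sub_lt hp ha1 hxy' hxp hyp hpy
  have hm0 : 0 < p - 1 := Nat.sub_pos_of_lt hp.one_lt
  refine IntermediateField.mem_of_forall_fixing _ fun σ hσ ↦ ?_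
  have hζ' : IsPrimitiveRoot (algebraMap F Ω ζ) (p - 1) :=
    hζ.map_of_injective (algebraMap F Ω).injective
  have : NeZero (p - 1) := ⟨hm0.ne'⟩
  refine apply_eq_self_of_norm_pow_sub_lt hm0 (norm_natCast_eq_one_of_coprime hpΩ ?_) hζ'
    (σ : Ω →+* Ω) (fun x ↦ (spectralNorm_eq_of_equiv σ x).symm) (fun t ht ↦ ?_)
    (σ.commutes a) hc (y := x - y) (hσ _ (sub_mem hxC hyC)) hlt
  · exact (Nat.coprime_of_lt_prime hm0.ne' (Nat.sub_lt hp.pos one_pos) hp).symm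
  · obtain ⟨i, -, rfl⟩ := hζ'.eq_pow_of_pow_eq_one ht
    rw [← map_pow]
    exact σ.commutes _

theorem radicalField_le_compositumOfDegree (hpF : ‖(p : F)‖ < 1) {ζ : F}
    (hζ : IsPrimitiveRoot ζ (p - 1)) {π : F} (hπ0 : 0 < ‖π‖) (hπ1 : ‖π‖ < 1)
    (hπ : ∀ x : F, x ≠ 0 → ∃ k : ℤ, ‖x‖ = ‖π‖ ^ k) :
    radicalField F Ω (p - 1) ≤ compositumOfDegree F Ω p := by
  have hp := (Fact.out : p.Prime)
  have hm0 : 0 < p - 1 := Nat.sub_pos_of_lt hp.one_lt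
  refine IntermediateField.adjoin_le_iff.2 ?_
  rintro c ⟨a, ha0, hc⟩
  obtain ⟨k, hk⟩ := hπ a ha0
  have hπne : π ≠ 0 := norm_pos_iff.1 hπ0
  -- multiplying `a` by a power of `π ^ (p - 1)`, the valuation can be taken in `[1, p - 1]`
  set r := (k - 1) % ((p - 1 : ℕ) : ℤ) with hr
  set q := (k - 1) / ((p - 1 : ℕ) : ℤ) with hq
  have hkr : k = (p - 1 : ℕ) * q + r + 1 := by
    have := Int.mul_ediv_add_emod (k - 1) ((p - 1 : ℕ) : ℤ)
    rw [← hr, ← hq] at this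
    linear_combination -this
  have hr0 : 0 ≤ r := Int.emod_nonneg _ (by omega)
  have hrp : r < (p - 1 : ℕ) := Int.emod_lt_of_pos _ (by omega)
  have hmem : c * algebraMap F Ω (π ^ (-q)) ∈ compositumOfDegree F Ω p := by
    refine mem_compositumOfDegree_of_pow_eq hpF hζ hπ0 hπ1 hπ (n := r.toNat + 1) (by omega)
      (by omega) (a := a * (π ^ (-q)) ^ (p - 1)) ?_ ?_
    · rw [norm_mul, norm_pow, norm_zpow, hk, ← zpow_natCast, ← zpow_mul, ← zpow_add₀ hπ0.ne',
        ← zpow_natCast]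
      congr 1
      push_cast [Int.toNat_of_nonneg hr0]
      rw [hkr]
      ring
    · rw [mul_pow, hc, ← map_pow, ← map_mul]
  have h1 : algebraMap F Ω (π ^ (-q)) ≠ 0 := by
    rw [Ne, map_eq_zero]; exact zpow_ne_zero _ hπne
  rw [← mul_div_cancel_right₀ c h1]
  exact div_mem hmem (algebraMap_mem _ _)

end InSepClosure

/-! ### Extensions of degree `p` and the maximal abelian extension of exponent `p` -/

section Compositum

variable {F Ω : Type*} [Field F] [Field Ω] [Algebra F Ω] {n : ℕ}

/-- Membership in the maximal abelian extension of an intermediate field, in terms of automorphisms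
over the bottom field. -/
theorem mem_maxAbelianField_iff_forall_fixing {K : IntermediateField F Ω} {x : Ω} :
    x ∈ maxAbelianField K Ω n ↔ ∀ σ : Gal(Ω/F), (∀ y ∈ K, σ y = y) → (σ ^ n) x = x ∧
      ∀ τ : Gal(Ω/F), (∀ y ∈ K, τ y = y) → σ (τ x) = τ (σ x) := by
  let e := IntermediateField.fixingSubgroupEquiv K
  have he (σ : K.fixingSubgroup) (z : Ω) : e σ z = (σ : Gal(Ω/F)) z := rfl
  constructor
  · rintro ⟨h1, h2⟩ σ hσ
    let σ' : K.fixingSubgroup := ⟨σ, (IntermediateField.mem_fixingSubgroup_iff _ _).2 hσ⟩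
    refine ⟨?_, fun τ hτ ↦ ?_⟩
    · have := h2 (e σ')
      rwa [← map_pow, he] at this
    · exact h1 (e σ') (e ⟨τ, (IntermediateField.mem_fixingSubgroup_iff _ _).2 hτ⟩)
  · intro h
    have hfix (σ : K.fixingSubgroup) : ∀ y ∈ K, (σ : Gal(Ω/F)) y = y :=
      (IntermediateField.mem_fixingSubgroup_iff _ _).1 σ.2
    refine ⟨fun σ τ ↦ ?_, fun σ ↦ ?_⟩
    · obtain ⟨σ, rfl⟩ := e.surjective σ
      obtain ⟨τ, rfl⟩ := e.surjective τ
      exact (h σ (hfix σ)).2 τ (hfix τ)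
    · obtain ⟨σ, rfl⟩ := e.surjective σ
      rw [← map_pow, he]
      exact (h σ (hfix σ)).1

theorem normal_maxAbelianField_restrictScalars [Normal F Ω] (K : IntermediateField F Ω)
    [Normal F K] : Normal F ((maxAbelianField K Ω n).restrictScalars F) := by
  refine IntermediateField.normal_iff_forall_map_le'.2 fun φ ↦ ?_
  rintro _ ⟨x, hx, rfl⟩
  have hx' := mem_maxAbelianField_iff_forall_fixing.1 hx
  have hK (φ : Gal(Ω/F)) {y : Ω} (hy : y ∈ K) : φ y ∈ K :=
    IntermediateField.normal_iff_forall_map_le'.1 ‹Normal F K› φ ⟨y, hy, rfl⟩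
  have hconj (σ : Gal(Ω/F)) (hσ : ∀ y ∈ K, σ y = y) : ∀ y ∈ K, (φ⁻¹ * σ * φ) y = y := by
    intro y hy
    rw [AlgEquiv.mul_apply, AlgEquiv.mul_apply, hσ _ (hK φ hy), ← AlgEquiv.mul_apply,
      inv_mul_cancel, AlgEquiv.one_apply]
  have hmul (σ : Gal(Ω/F)) (z : Ω) : φ ((φ⁻¹ * σ * φ) z) = σ (φ z) := by
    simp only [← AlgEquiv.mul_apply]
    congr 1
    group
  refine mem_maxAbelianField_iff_forall_fixing.2 fun σ hσ ↦ ⟨?_, fun τ hτ ↦ ?_⟩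
  · have h1 := (hx' _ (hconj σ hσ)).1
    have h2 : (φ⁻¹ * σ * φ) ^ n = φ⁻¹ * σ ^ n * φ := by
      simpa using conj_pow (a := φ⁻¹) (b := σ) (i := n)
    rw [h2] at h1
    change (σ ^ n) (φ x) = φ x
    rw [← hmul, h1]
  · have h1 := (hx' _ (hconj σ hσ)).2 _ (hconj τ hτ)
    change σ (τ (φ x)) = τ (σ (φ x))
    rw [← hmul τ, ← hmul σ, ← hmul σ, ← hmul τ, h1]

variable {p : ℕ} [Fact p.Prime] [IsGalois F Ω]

/-- If the finite Galois groups over `F` are solvable, every separable extension of degree `p`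
becomes abelian of exponent dividing `p` over the maximal abelian extension of `F` of exponent
dividing `p - 1`: the Galois group of its normal closure is affine, with group of translations
`N`, and the fixed field of `N` is abelian of exponent dividing `p - 1`. -/
theorem le_maxAbelianField_of_finrank_eq (hsolv : ∀ L : IntermediateField F Ω,
      FiniteDimensional F L → Group.IsSolvable Gal(L/F))
    (E : IntermediateField F Ω) (hE : Module.finrank F E = p) :
    E ≤ (maxAbelianField (maxAbelianField F Ω (p - 1)) Ω p).restrictScalars F := by
  have hfd : FiniteDimensional F E :=
    Module.finite_of_finrank_pos (hE ▸ (Fact.out : p.Prime).pos)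
  set L := IntermediateField.normalClosure F E Ω with hL
  have hEL : E ≤ L := IntermediateField.le_normalClosure E
  have := hsolv L inferInstance
  have hρ (σ : Gal(Ω/F)) (x : L) : (AlgEquiv.restrictNormalHom L σ x : Ω) = σ x :=
    AlgEquiv.restrictNormal_commutes σ L x
  set S := (IntermediateField.restrict hEL).fixingSubgroup with hS
  have hindex : S.index = p := by
    rw [hS, ← IntermediateField.finrank_eq_fixingSubgroup_index, ← hE]
    exact (IntermediateField.restrictAlgEquiv hEL).toLinearEquiv.finrank_eq.symm
  have hcore : S.normalCore = ⊥ := by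
    set T := IntermediateField.fixedField S.normalCore with hT
    have : Normal F T := inferInstance
    have : Normal F (IntermediateField.lift T) :=
      Normal.of_algEquiv (IntermediateField.liftAlgEquiv T)
    have h1 : E ≤ IntermediateField.lift T := by
      intro x hx
      refine ⟨⟨x, hEL hx⟩, ?_, rfl⟩
      refine (IntermediateField.mem_fixedField_iff _ _).2 fun σ hσ ↦ ?_
      exact (IntermediateField.mem_fixingSubgroup_iff _ _).1 (S.normalCore_le hσ) _
        ((IntermediateField.mem_restrict hEL _).2 hx)
    have h2 : L ≤ IntermediateField.lift T :=
      IntermediateField.normalClosure_le_iff_of_normal.2 h1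
    rw [← IntermediateField.fixingSubgroup_fixedField S.normalCore, ← hT]
    refine (Subgroup.eq_bot_iff_forall _).2 fun σ hσ ↦ AlgEquiv.ext fun x ↦ ?_
    obtain ⟨y, hy, hyx⟩ := h2 x.2
    have hyx' : y = x := Subtype.ext hyx
    exact (IntermediateField.mem_fixingSubgroup_iff _ _).1 hσ x (hyx' ▸ hy)
  obtain ⟨N, hN, hcomm, hexp, hpow, hder⟩ :=
    exists_normal_of_isSolvable_of_index_eq_prime S hindex hcore
  have hT (y : L) (hy : ∀ g ∈ N, g y = y) : (y : Ω) ∈ maxAbelianField F Ω (p - 1) := by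
    refine ⟨fun σ τ ↦ ?_, fun σ ↦ ?_⟩
    · set g := AlgEquiv.restrictNormalHom L σ
      set h := AlgEquiv.restrictNormalHom L τ
      have h1 : g * h = h * g * (g⁻¹ * h⁻¹ * g⁻¹⁻¹ * h⁻¹⁻¹) := by group
      have h2 : (g * h) y = (h * g) y := by
        rw [h1, AlgEquiv.mul_apply (h * g), hy _ (hder g⁻¹ h⁻¹)]
      rw [← hρ, ← hρ, ← hρ, ← hρ]
      exact congrArg Subtype.val h2
    · rw [← hρ, map_pow, hy _ (hpow _)]
  have hmem (σ : Gal(Ω/F)) (hσ : ∀ y ∈ maxAbelianField F Ω (p - 1), σ y = y) :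
      AlgEquiv.restrictNormalHom L σ ∈ N := by
    rw [← IntermediateField.fixingSubgroup_fixedField N]
    refine (IntermediateField.mem_fixingSubgroup_iff _ _).2 fun y hy ↦ Subtype.ext ?_
    rw [hρ]
    exact hσ _ (hT y ((IntermediateField.mem_fixedField_iff _ _).1 hy))
  intro x hx
  refine mem_maxAbelianField_iff_forall_fixing.2 fun σ hσ ↦ ⟨?_, fun τ hτ ↦ ?_⟩
  · rw [← hρ (σ ^ p) ⟨x, hEL hx⟩, map_pow, hexp _ (hmem σ hσ)]
    rfl
  · have h1 := hcomm _ (hmem σ hσ) _ (hmem τ hτ)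
    have h2 := congrArg Subtype.val (DFunLike.congr_fun h1 ⟨x, hEL hx⟩)
    simpa only [AlgEquiv.mul_apply, hρ] using h2

/-- An element of exponent `p` over a finite abelian extension `K₀` of `F` of exponent dividing
`p - 1` lies in the compositum of `K₀` and the extensions of `F` of degree `p`. -/
theorem mem_compositumOfDegree_of_mem_maxAbelianField (K₀ : IntermediateField F Ω)
    [FiniteDimensional F K₀] (hK₀ : K₀ ≤ maxAbelianField F Ω (p - 1))
    (hK₀C : K₀ ≤ compositumOfDegree F Ω p) {y : Ω} (hy : y ∈ maxAbelianField K₀ Ω p) :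
    y ∈ compositumOfDegree F Ω p := by
  have := normal_of_le_maxAbelianField hK₀
  have hfd : FiniteDimensional F (IntermediateField.adjoin F {y}) :=
    IntermediateField.adjoin.finiteDimensional (Algebra.IsIntegral.isIntegral y)
  set L := IntermediateField.normalClosure F (K₀ ⊔ IntermediateField.adjoin F {y} :
    IntermediateField F Ω) Ω with hL
  have hle : K₀ ⊔ IntermediateField.adjoin F {y} ≤ L := IntermediateField.le_normalClosure _
  have hK₀L : K₀ ≤ L := le_sup_left.trans hle
  have hyL : y ∈ L :=
    hle ((le_sup_right : _ ≤ K₀ ⊔ _) (IntermediateField.mem_adjoin_simple_self F y))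
  have hLA : L ≤ (maxAbelianField K₀ Ω p).restrictScalars F := by
    have := normal_maxAbelianField_restrictScalars (n := p) K₀
    refine IntermediateField.normalClosure_le_iff_of_normal.2 (sup_le (fun x hx ↦ ?_) ?_)
    · exact algebraMap_mem (maxAbelianField K₀ Ω p) (⟨x, hx⟩ : K₀)
    · exact IntermediateField.adjoin_simple_le_iff.2 hy
  have hρ (σ : Gal(Ω/F)) (x : L) : (AlgEquiv.restrictNormalHom L σ x : Ω) = σ x :=
    AlgEquiv.restrictNormal_commutes σ L x
  set V := (IntermediateField.restrict hK₀L).fixingSubgroup with hV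
  have hVmem (σ : Gal(Ω/F)) : AlgEquiv.restrictNormalHom L σ ∈ V ↔ ∀ x ∈ K₀, σ x = x := by
    rw [hV, IntermediateField.mem_fixingSubgroup_iff]
    constructor
    · intro h x hx
      have := congrArg Subtype.val
        (h ⟨x, hK₀L hx⟩ ((IntermediateField.mem_restrict hK₀L _).2 hx))
      rwa [hρ] at this
    · intro h x hx
      refine Subtype.ext ?_
      rw [hρ, h _ ((IntermediateField.mem_restrict hK₀L _).1 hx)]
  have hder (g h : Gal(L/F)) : g * h * g⁻¹ * h⁻¹ ∈ V := by
    obtain ⟨σ, rfl⟩ := AlgEquiv.restrictNormalHom_surjective Ω g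
    obtain ⟨τ, rfl⟩ := AlgEquiv.restrictNormalHom_surjective Ω h
    rw [← map_inv, ← map_inv, ← map_mul, ← map_mul, ← map_mul, hVmem]
    intro x hx
    have h1 := (hK₀ hx).1 σ⁻¹ τ⁻¹
    simp only [AlgEquiv.mul_apply, h1]
    simp only [← AlgEquiv.mul_apply]
    simp
  have hVn : V.Normal := ⟨fun v hv g ↦ by
    have := V.mul_mem (hder g v) hv
    simpa [mul_assoc] using this⟩
  refine IntermediateField.mem_of_forall_fixing _ fun σ hσ ↦ ?_
  have h1 : AlgEquiv.restrictNormalHom L σ = 1 := by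
    refine eq_one_of_forall_mem_of_index_eq_prime (p := p) V ?_ ?_ ?_ hder
      ((hVmem σ).2 fun x hx ↦ hσ x (hK₀C hx)) fun H hH ↦ ?_
    · intro a ha b hb
      obtain ⟨σ, rfl⟩ := AlgEquiv.restrictNormalHom_surjective Ω a
      obtain ⟨τ, rfl⟩ := AlgEquiv.restrictNormalHom_surjective Ω b
      refine AlgEquiv.ext fun x ↦ Subtype.ext ?_
      simp only [AlgEquiv.mul_apply, hρ]
      exact (mem_maxAbelianField_iff_forall_fixing.1 (hLA x.2) σ ((hVmem σ).1 ha)).2 τ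
        ((hVmem τ).1 hb)
    · intro a ha
      obtain ⟨σ, rfl⟩ := AlgEquiv.restrictNormalHom_surjective Ω a
      refine AlgEquiv.ext fun x ↦ Subtype.ext ?_
      rw [← map_pow, hρ]
      exact (mem_maxAbelianField_iff_forall_fixing.1 (hLA x.2) σ ((hVmem σ).1 ha)).1
    · intro g
      obtain ⟨σ, rfl⟩ := AlgEquiv.restrictNormalHom_surjective Ω g
      rw [← map_pow, hVmem]
      exact fun x hx ↦ (hK₀ hx).2 σ
    · have hE : IntermediateField.lift (IntermediateField.fixedField H) ≤
          compositumOfDegree F Ω p := le_sSup ⟨inferInstance, by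
        rw [← (IntermediateField.liftAlgEquiv _).toLinearEquiv.finrank_eq,
          IntermediateField.finrank_eq_fixingSubgroup_index,
          IntermediateField.fixingSubgroup_fixedField, hH]⟩
      rw [← IntermediateField.fixingSubgroup_fixedField H]
      refine (IntermediateField.mem_fixingSubgroup_iff _ _).2 fun x hx ↦ Subtype.ext ?_
      rw [hρ]
      exact hσ _ (hE ⟨x, hx, rfl⟩)
  rw [← hρ σ ⟨y, hyL⟩, h1]
  rfl

omit [IsGalois F Ω] in
/-- The cyclotomic extension generated by the `p`-th roots of unity is abelian of exponent
dividing `p - 1`. -/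
theorem IsPrimitiveRoot.mem_maxAbelianField {ζ : Ω} (hζ : IsPrimitiveRoot ζ p) :
    ζ ∈ maxAbelianField F Ω (p - 1) := by
  have hp := (Fact.out : p.Prime)
  have : NeZero p := ⟨hp.ne_zero⟩
  have key (σ : Gal(Ω/F)) : ∃ i : ℕ, i.Coprime p ∧ σ ζ = ζ ^ i := by
    obtain ⟨i, -, hi, h⟩ := hζ.isPrimitiveRoot_iff.1
      (hζ.map_of_injective (f := (σ : Ω →+* Ω)) σ.injective)
    exact ⟨i, hi, h.symm⟩
  refine ⟨fun σ τ ↦ ?_, fun σ ↦ ?_⟩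
  · obtain ⟨i, -, hi⟩ := key σ
    obtain ⟨j, -, hj⟩ := key τ
    rw [hi, hj, map_pow, map_pow, hi, hj, ← pow_mul, ← pow_mul, mul_comm]
  · obtain ⟨i, hip, hi⟩ := key σ
    have h1 (m : ℕ) : (σ ^ m) ζ = ζ ^ i ^ m := by
      induction m with
      | zero => simp
      | succ m ih =>
        rw [pow_succ, AlgEquiv.mul_apply, hi, map_pow, ih, ← pow_mul, ← pow_succ]
    rw [h1]
    conv_rhs => rw [← pow_one ζ]
    exact pow_eq_pow_of_modEq (Nat.totient_prime hp ▸ Nat.ModEq.pow_totient hip) hζ.pow_eq_one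

end Compositum

/-! ### The main theorem over a normed local field -/

section Main

variable {F : Type*} [NontriviallyNormedField F] [IsUltrametricDist F] [ProperSpace F] {p : ℕ}
  [Fact p.Prime] {Ω : Type*} [Field Ω] [Algebra F Ω] [IsSepClosure F Ω]

open Polynomial in
theorem exists_natDegree_minpoly_eq {π : F} (hπ0 : 0 < ‖π‖) (hπ1 : ‖π‖ < 1)
    (hπ : ∀ x : F, x ≠ 0 → ∃ k : ℤ, ‖x‖ = ‖π‖ ^ k) :
    ∃ x : Ω, (minpoly F x).natDegree = p := by
  have hp := (Fact.out : p.Prime)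
  have : IsSepClosed Ω := IsSepClosure.sep_closed F
  obtain ⟨hdeg, hmonic⟩ := natDegree_X_pow_sub_C_mul_X_sub_C hp.one_lt π
  have hirr := irreducible_X_pow_sub_C_mul_X_sub_C hπ0 hπ1 hπ one_pos hp.one_lt (pow_one ‖π‖).symm
  obtain ⟨x, hx⟩ := IsSepClosed.exists_aeval_eq_zero Ω _ (by
    rw [degree_eq_natDegree hmonic.ne_zero, hdeg]; exact_mod_cast hp.ne_zero)
    (separable_X_pow_sub_C_mul_X_sub_C hirr)
  exact ⟨x, by rw [← minpoly.eq_of_irreducible_of_monic hirr hx hmonic, hdeg]⟩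

/-- The theorem for a normed field `F`, locally compact and ultrametric, with uniformizer `π`. -/
theorem exists_isMaximalAbelianOfExponent (hpF : ‖(p : F)‖ < 1) {ζ : F}
    (hζ : IsPrimitiveRoot ζ (p - 1)) {π : F} (hπ0 : 0 < ‖π‖) (hπ1 : ‖π‖ < 1)
    (hπ : ∀ x : F, x ≠ 0 → ∃ k : ℤ, ‖x‖ = ‖π‖ ^ k) (hchar : CharZero F ∨ CharP F p) :
    ∃ M : IntermediateField (radicalField F Ω (p - 1)) Ω,
      M.restrictScalars F = compositumOfDegree F Ω p ∧
      IsMaximalAbelianOfExponent p M ∧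
      (CharZero F → M = radicalField (radicalField F Ω (p - 1)) Ω p) ∧
      (CharP F p → M = artinSchreierField (radicalField F Ω (p - 1)) Ω p) := by
  have hp := (Fact.out : p.Prime)
  have : NeZero (p - 1) := ⟨(Nat.sub_pos_of_lt hp.one_lt).ne'⟩
  have : NeZero p := ⟨hp.ne_zero⟩
  have : IsSepClosed Ω := IsSepClosure.sep_closed F
  have hKC := radicalField_le_compositumOfDegree (Ω := Ω) hpF hζ hπ0 hπ1 hπ
  have hK : maxAbelianField F Ω (p - 1) = radicalField F Ω (p - 1) :=
    maxAbelianField_eq_radicalField hζ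
  set K := radicalField F Ω (p - 1) with hKdef
  have hcharZero (h : CharZero F) : ∃ z : Ω, IsPrimitiveRoot z p := by
    have := charZero_of_injective_algebraMap (algebraMap F Ω).injective
    have : NeZero (p : Ω) := ⟨Nat.cast_ne_zero.2 hp.ne_zero⟩
    exact HasEnoughRootsOfUnity.exists_primitiveRoot Ω p
  have hmem {z : Ω} (hz : IsPrimitiveRoot z p) : z ∈ K := hK ▸ hz.mem_maxAbelianField
  have hroot {z : Ω} (hz : IsPrimitiveRoot z p) (K' : IntermediateField F Ω) (hzK : z ∈ K') :
      maxAbelianField K' Ω p = radicalField K' Ω p :=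
    maxAbelianField_eq_radicalField (ζ := (⟨z, hzK⟩ : K'))
      (IsPrimitiveRoot.of_map_of_injective (f := algebraMap K' Ω) hz (algebraMap K' Ω).injective)
  have has (h : CharP F p) (K' : IntermediateField F Ω) :
      maxAbelianField K' Ω p = artinSchreierField K' Ω p := by
    have := charP_of_injective_algebraMap (algebraMap F K').injective p
    exact maxAbelianField_eq_artinSchreierField
  -- descent of Kummer and Artin-Schreier generators to finite subextensions of `K`
  have hdesc (s : Set Ω) (hs : s ⊆ K) (hfin : s.Finite) {y : Ω}
      (hy : y ∈ maxAbelianField (IntermediateField.adjoin F s) Ω p) :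
      y ∈ compositumOfDegree F Ω p := by
    have := hfin.to_subtype
    have : FiniteDimensional F (IntermediateField.adjoin F s) :=
      IntermediateField.finiteDimensional_adjoin fun x _ ↦ Algebra.IsIntegral.isIntegral x
    have hle : IntermediateField.adjoin F s ≤ K := IntermediateField.adjoin_le_iff.2 hs
    exact mem_compositumOfDegree_of_mem_maxAbelianField _ (hK ▸ hle) (hle.trans hKC) hy
  have hMC : (maxAbelianField K Ω p).restrictScalars F = compositumOfDegree F Ω p := by
    refine le_antisymm ?_ (sSup_le fun E hE ↦ ?_)
    · let C' : IntermediateField K Ω := IntermediateField.extendScalars hKC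
      suffices maxAbelianField K Ω p ≤ C' from this
      rcases hchar with h | h
      · obtain ⟨z, hz⟩ := hcharZero h
        rw [hroot hz K (hmem hz)]
        refine IntermediateField.adjoin_le_iff.2 ?_
        rintro y ⟨a, ha, hy⟩
        refine hdesc {(a : Ω), z} ?_ (Set.toFinite _) ?_
        · rintro _ (rfl | rfl)
          · exact a.2
          · exact hmem hz
        · rw [hroot hz _ (IntermediateField.subset_adjoin _ _ (by simp))]
          refine IntermediateField.subset_adjoin _ _
            ⟨⟨a, IntermediateField.subset_adjoin _ _ (by simp)⟩, ?_, hy⟩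
          intro h0
          have h1 := congrArg (algebraMap _ Ω) h0
          exact ha (Subtype.ext (by simpa using h1))
      · rw [has h K]
        refine IntermediateField.adjoin_le_iff.2 ?_
        rintro y ⟨a, hy⟩
        refine hdesc {(a : Ω)} ?_ (Set.toFinite _) ?_
        · rintro _ rfl
          exact a.2
        · rw [has h]
          exact IntermediateField.subset_adjoin _ _
            ⟨⟨a, IntermediateField.subset_adjoin _ _ (by simp)⟩, hy⟩
    · rw [← hK]
      exact le_maxAbelianField_of_finrank_eq (fun L _ ↦ isSolvable_gal hpF) E hE.2
  have hexp : Monoid.exponent Gal(maxAbelianField K Ω p/K) ∣ p :=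
    Monoid.exponent_dvd_iff_forall_pow_eq_one.2 (pow_eq_one_of_le_maxAbelianField le_rfl)
  refine ⟨maxAbelianField K Ω p, hMC, ⟨isAbelianGalois_of_le_maxAbelianField le_rfl, ?_,
    fun L _ hL ↦ le_maxAbelianField L hL⟩, fun h ↦ ?_, fun h ↦ has h K⟩
  · refine ((Nat.dvd_prime hp).1 hexp).resolve_left fun h1 ↦ ?_
    -- otherwise a generator of an extension of degree `p` lies in `K`, of exponent `p - 1`
    obtain ⟨x, hx⟩ := exists_natDegree_minpoly_eq (Ω := Ω) (p := p) hπ0 hπ1 hπ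
    have hxM : x ∈ maxAbelianField K Ω p := by
      have : x ∈ compositumOfDegree F Ω p := mem_compositumOfDegree hx
      rwa [← hMC] at this
    have hxK : x ∈ K := by
      have := isAbelianGalois_of_le_maxAbelianField (le_refl (maxAbelianField K Ω p))
      have hbot : (⟨x, hxM⟩ : maxAbelianField K Ω p) ∈
          (⊥ : IntermediateField K (maxAbelianField K Ω p)) := by
        rw [InfiniteGalois.mem_bot_iff_fixed]
        intro σ
        have := Monoid.exponent_dvd_iff_forall_pow_eq_one.1 h1.dvd σ
        rw [pow_one] at this
        rw [this, AlgEquiv.one_apply]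
      obtain ⟨t, ht⟩ := IntermediateField.mem_bot.1 hbot
      have := congrArg Subtype.val ht
      exact (show (t : Ω) = x from this) ▸ t.2
    have hle : IntermediateField.adjoin F {x} ≤ maxAbelianField F Ω (p - 1) :=
      IntermediateField.adjoin_simple_le_iff.2 (hK ▸ hxK)
    have hfd : FiniteDimensional F (IntermediateField.adjoin F {x}) :=
      IntermediateField.adjoin.finiteDimensional (Algebra.IsIntegral.isIntegral x)
    have := isAbelianGalois_of_le_maxAbelianField hle
    have hcard : Nat.card Gal(IntermediateField.adjoin F {x}/F) = p := by
      rw [IsGalois.card_aut_eq_finrank,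
        IntermediateField.adjoin.finrank (Algebra.IsIntegral.isIntegral x), hx]
    obtain ⟨g, hg⟩ := exists_prime_orderOf_dvd_card' p hcard.symm.dvd
    have h2 := orderOf_dvd_of_pow_eq_one (pow_eq_one_of_le_maxAbelianField hle g)
    rw [hg] at h2
    exact (Nat.sub_lt hp.pos one_pos).not_ge (Nat.le_of_dvd (Nat.sub_pos_of_lt hp.one_lt) h2)
  · obtain ⟨z, hz⟩ := hcharZero h
    exact hroot hz K (hmem hz)

end Main

/-! ### Non-archimedean local fields -/

section LocalField

variable (p : ℕ) [Fact p.Prime] (F : Type*) [Field F] [ValuativeRel F] [TopologicalSpace F]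
  [IsNonarchimedeanLocalField F] [CharP 𝓀[F] p]

theorem charZero_or_charP_of_residueField : CharZero F ∨ CharP F p := by
  obtain ⟨q, hq⟩ := CharP.exists F
  rcases CharP.char_is_prime_or_zero F q with hq' | rfl
  · right
    have h1 : (q : 𝒪[F]) = 0 := Subtype.ext (by simp)
    have h2 : (q : 𝓀[F]) = 0 := by
      rw [← map_natCast (IsLocalRing.residue 𝒪[F]), h1, map_zero]
    rw [CharP.cast_eq_zero_iff 𝓀[F] p, Nat.prime_dvd_prime_iff_eq Fact.out hq'] at h2
    exact h2 ▸ hq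
  · exact Or.inl (CharP.charP_to_charZero F)

/-- The Teichmüller lift of a generator of `(ZMod p)ˣ`, by Hensel's lemma. -/
theorem exists_isPrimitiveRoot_sub_one : ∃ ζ : F, IsPrimitiveRoot ζ (p - 1) := by
  have hp := (Fact.out : p.Prime)
  let := IsTopologicalAddGroup.rightUniformSpace F
  have := isUniformAddGroup_of_addCommGroup (G := F)
  have : HenselianRing 𝒪[F] 𝓂[F] := inferInstance
  obtain ⟨u, hu⟩ := IsCyclic.exists_generator (α := (ZMod p)ˣ)
  have hu1 : IsPrimitiveRoot u (p - 1) := by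
    have h1 := IsPrimitiveRoot.orderOf u
    rwa [orderOf_eq_card_of_forall_mem_zpowers hu, Nat.card_eq_fintype_card,
      ZMod.card_units] at h1
  have hu2 : IsPrimitiveRoot (ZMod.castHom dvd_rfl 𝓀[F] (u : ZMod p)) (p - 1) :=
    (IsPrimitiveRoot.coe_units_iff.2 hu1).map_of_injective (RingHom.injective _)
  set v := ZMod.castHom dvd_rfl 𝓀[F] (u : ZMod p)
  obtain ⟨a₀, ha₀⟩ := IsLocalRing.residue_surjective (R := 𝒪[F]) v
  obtain ⟨a, ha, haa₀⟩ := HenselianRing.is_henselian (R := 𝒪[F]) (I := 𝓂[F])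
    (Polynomial.X ^ (p - 1) - Polynomial.C 1)
    (Polynomial.monic_X_pow_sub_C 1 (Nat.sub_pos_of_lt hp.one_lt).ne') a₀ (by
      rw [← IsLocalRing.residue_eq_zero_iff]
      simp [ha₀, hu2.pow_eq_one]) (by
      change IsUnit (IsLocalRing.residue 𝒪[F] _)
      rw [isUnit_iff_ne_zero]
      have hv0 : v ≠ 0 := hu2.ne_zero (Nat.sub_pos_of_lt hp.one_lt).ne'
      have hp1 : ((p - 1 : ℕ) : 𝓀[F]) ≠ 0 := by
        rw [Ne, CharP.cast_eq_zero_iff 𝓀[F] p]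
        exact Nat.not_dvd_of_pos_of_lt (Nat.sub_pos_of_lt hp.one_lt) (Nat.sub_lt hp.pos one_pos)
      rw [Polynomial.derivative_sub, Polynomial.derivative_C, sub_zero, Polynomial.derivative_X_pow]
      simp only [Polynomial.eval_mul, Polynomial.eval_natCast, Polynomial.eval_pow, Polynomial.eval_X,
        map_mul, map_pow, map_natCast, ha₀]
      exact mul_ne_zero hp1 (pow_ne_zero _ hv0))
  have hav : IsLocalRing.residue 𝒪[F] a = v := by
    rw [← ha₀, ← sub_eq_zero, ← map_sub, IsLocalRing.residue_eq_zero_iff]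
    exact haa₀
  have ha1 : a ^ (p - 1) = 1 := by
    have : a ^ (p - 1) - 1 = 0 := by simpa using ha
    exact sub_eq_zero.1 this
  refine ⟨a, IsPrimitiveRoot.map_of_injective (f := 𝒪[F].subtype) ⟨ha1, fun l hl ↦ ?_⟩
    Subtype.val_injective⟩
  refine hu2.dvd_of_pow_eq_one l ?_
  rw [← hav, ← map_pow, hl, map_one]

end LocalField

theorem proposition36 (p : ℕ) [Fact p.Prime]
    (F : Type*) [Field F] [ValuativeRel F] [TopologicalSpace F] [IsNonarchimedeanLocalField F]
    [CharP 𝓀[F] p]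
    (Ω : Type*) [Field Ω] [Algebra F Ω] [IsSepClosure F Ω] :
    ∃ M : IntermediateField (radicalField F Ω (p - 1)) Ω,
      M.restrictScalars F = compositumOfDegree F Ω p ∧
      IsMaximalAbelianOfExponent p M ∧
      (CharZero F → M = radicalField (radicalField F Ω (p - 1)) Ω p) ∧
      (CharP F p → M = artinSchreierField (radicalField F Ω (p - 1)) Ω p) := by
  obtain ⟨ζ, hζ⟩ := exists_isPrimitiveRoot_sub_one p F
  have hchar := charZero_or_charP_of_residueField p F
  let := IsTopologicalAddGroup.rightUniformSpace F
  have := isUniformAddGroup_of_addCommGroup (G := F)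
  let : (Valued.v (R := F) (Γ₀ := ValuativeRel.ValueGroupWithZero F)).RankOne :=
    { hom' := ValuativeRel.IsRankLeOne.nonempty.some.emb (R := F).comp
        MonoidWithZeroHom.ValueGroup₀.embedding
      strictMono' := ValuativeRel.IsRankLeOne.nonempty.some.strictMono.comp
        MonoidWithZeroHom.ValueGroup₀.embedding_strictMono }
  let : NontriviallyNormedField F := Valued.toNontriviallyNormedField (L := F)
    (Γ₀ := ValuativeRel.ValueGroupWithZero F)
  have : ProperSpace F := .of_nontriviallyNormedField_of_weaklyLocallyCompactSpace F
  have : IsUltrametricDist F := inferInstance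
  have hlt (x : F) : ‖x‖ < 1 ↔ ValuativeRel.valuation F x < 1 :=
    Valued.toNormedField.norm_lt_one_iff
  have heq (x y : F) (h : ValuativeRel.valuation F x = ValuativeRel.valuation F y) :
      ‖x‖ = ‖y‖ :=
    le_antisymm (Valued.toNormedField.norm_le_iff.2 h.le) (Valued.toNormedField.norm_le_iff.2 h.ge)
  have hpF : ‖(p : F)‖ < 1 := by
    have h1 : IsLocalRing.residue 𝒪[F] (p : 𝒪[F]) = 0 := by
      rw [map_natCast, CharP.cast_eq_zero]
    rw [IsLocalRing.residue_eq_zero_iff, IsLocalRing.mem_maximalIdeal, mem_nonunits_iff,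
      Valuation.Integer.not_isUnit_iff_valuation_lt_one] at h1
    rw [hlt]
    simpa using h1
  let e := IsNonarchimedeanLocalField.valueGroupWithZeroIsoInt F
  obtain ⟨π, hπ⟩ := ValuativeRel.valuation_surjective (e.symm (WithZero.exp (-1)))
  have heπ : e (ValuativeRel.valuation F π) = WithZero.exp (-1) := by rw [hπ]; simp
  have hπne : π ≠ 0 := by
    rintro rfl
    rw [map_zero, map_zero] at heπ
    exact WithZero.exp_ne_zero heπ.symm
  refine exists_isMaximalAbelianOfExponent (F := F) hpF hζ (norm_pos_iff.2 hπne) ?_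
    (fun x hx ↦ ?_) hchar
  · rw [hlt, ← e.strictMono.lt_iff_lt, heπ, map_one]
    exact WithZero.exp_lt_exp.2 (by norm_num : (-1 : ℤ) < 0)
  · have hex : e (ValuativeRel.valuation F x) ≠ 0 := by simpa using hx
    refine ⟨-WithZero.log (e (ValuativeRel.valuation F x)), ?_⟩
    rw [← norm_zpow]
    refine heq _ _ (e.strictMono.injective ?_)
    rw [map_zpow₀, map_zpow₀, heπ, ← WithZero.exp_zsmul]
    simp [WithZero.exp_log hex]
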